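/- Let $X,Z,Y$ be binary with $X,Z$ independent, $p(X=1)=p_X\in(0,1)$, $p(Z=1)=p_Z\in(0,1)$ and $p(Y=1\mid X=x,Z=z)=p_{Y}(x,z)\in[0,1]$. From $N$ independent observations of $(X,Z,Y)$ let $N_{xzy}$ be the number equal to $(x,z,y)$, $N_{xz}=N_{xz0}+N_{xz1}$, and consider the two estimators of the effect of $X$ on $Y$ $$R=R_1-R_0,\quad R_x=\frac{N_{x01}+N_{x11}}{N_{x0}+N_{x1}},\qquad M=M_1-M_0,\quad M_x=\sum_{z\in\{0,1\}}\frac{N_{xz1}}{N_{xz}}\cdot\frac{N_{0z}+N_{1z}}{N},$$ where $0/0:=0$, and $P(\alpha)=\alpha R+(1-\alpha)M$. Let $V$ and $C[\cdot,\cdot]$ denote variance and covariance, and put $\alpha^*=\dfrac{V[M]-C[R,M]}{(V[R]-C[R,M])+(V[M]-C[R,M])}$. (a) For all such parameters and every $N$: if $C[R,M]<\min(V[R],V[M])$, then $V[P(\alpha^*)]\le V[P(\alpha)]$ for all $\alpha\in\mathbb R$, and $V[P(\alpha^*)]<\min(V[R],V[M])$. (b) Fix $p_X,p_Z\in(0,1)$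 and $q_0,q_1\in\mathbb R$, let $C=C_N$ and $D=D_N$ be real sequences with $C_N=O(N^{-1/2})$ and $D_N=O(N^{-1/2})$, and let $$p_Y(0,0)=q_0-C-Dp_Z,\quad p_Y(0,1)=q_0+C+D(1-p_Z),\quad p_Y(1,0)=q_1-C+Dp_Z,\quad p_Y(1,1)=q_1+C-D(1-p_Z),$$ assumed to lie in $[0,1]$ for all large $N$. Then, as $N\to\infty$, $$(C[R,M]-V[R])\,N=-\frac{p_Z(1-p_Z)}{p_X(1-p_X)}\bigl[2C+(2p_X-1)D\bigr]^2+O(N^{-3/2}),$$ $$(C[R,M]-V[M])\,N=-\frac{q_1(1-q_1)(1-p_X)}{Np_X^2}-\frac{q_0(1-q_0)p_X}{N(1-p_X)^2}+O(N^{-3/2}),$$ and both leading terms are non-positive. If moreover $q_0\in(0,1)$ or $q_1\in(0,1)$, and $N^{-1/2}=O\bigl(2C_N+(2p_X-1)D_N\bigr)$ (that is, both leading terms are of exact order $N^{-1}$), then for all sufficiently large $N$ $$C[R,M]<\min(V[R],V[M])\qquad\text{and}\qquad V[P(\alpha^*)]<\min(V[R],V[M]).$$ -/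

import Mathlib

open MeasureTheory ProbabilityTheory Filter Asymptotics

noncomputable section

namespace VStructure

/-- Parameters of the binary v-structure `X → Y ← Z`:
`pX = p(X = 1)`, `pZ = p(Z = 1)` and `pY x z = p(Y = 1 ∣ X = x, Z = z)`. -/
structure Params where
  pX : ℝ
  pZ : ℝ
  pY : Bool → Bool → ℝ

/-- The entries of the probability tables are probabilities, and those of `X` and `Z` are
nondegenerate, so that all four combinations of `X` and `Z` have positive probability. -/
def Params.Valid (θ : Params) : Prop :=
  (0 < θ.pX ∧ θ.pX < 1) ∧ (0 < θ.pZ ∧ θ.pZ < 1) ∧ ∀ x z, 0 ≤ θ.pY x z ∧ θ.pY x z ≤ 1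

/-- The parametrisation of the outcome probabilities by `q₀, q₁, C, D`. -/
def interactionParams (pX pZ q₀ q₁ C D : ℝ) : Params where
  pX := pX
  pZ := pZ
  pY := fun x z =>
    match x, z with
    | false, false => q₀ - C - D * pZ
    | false, true => q₀ + C + D * (1 - pZ)
    | true, false => q₁ - C + D * pZ
    | true, true => q₁ + C - D * (1 - pZ)

/-- One observation `(X, Z, Y)`. -/
abbrev Obs : Type := Bool × Bool × Bool

/-- A sample of `N` observations. -/
abbrev Sample (N : ℕ) : Type := Fin N → Obs

/-- `bern p b` is the probability that a Bernoulli variable with parameter `p` equals `b`. -/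
def bern (p : ℝ) (b : Bool) : ℝ := if b then p else 1 - p

/-- The probability `p(X = x) p(Z = z) p(Y = y ∣ X = x, Z = z)` of the observation `(x, z, y)`. -/
def Params.prob (θ : Params) (a : Obs) : ℝ :=
  bern θ.pX a.1 * bern θ.pZ a.2.1 * bern (θ.pY a.1 a.2.1) a.2.2

/-- The law of one observation. -/
def Params.obsLaw (θ : Params) : Measure Obs :=
  ∑ a : Obs, ENNReal.ofReal (θ.prob a) • Measure.dirac a

/-- The law of a sample of `N` independent observations. -/
def Params.sampleLaw (θ : Params) (N : ℕ) : Measure (Sample N) :=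
  Measure.pi fun _ => θ.obsLaw

section Estimators

variable {N : ℕ}

/-- The number of observations in the sample that are equal to `(x, z, y)`. -/
def cnt (x z y : Bool) (ω : Sample N) : ℝ :=
  ((Finset.univ.filter fun i => ω i = (x, z, y)).card : ℝ)

/-- The number of observations in the sample with `X = x` and `Z = z`. -/
def cntXZ (x z : Bool) (ω : Sample N) : ℝ := cnt x z false ω + cnt x z true ω

/-- The estimate of `p(Y = 1 ∣ X = x)` from raw conditionals
(`0` if there is no observation with `X = x`). -/
def rawCond (x : Bool) (ω : Sample N) : ℝ :=
  (cnt x false true ω + cnt x true true ω) / (cntXZ x false ω + cntXZ x true ω)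

/-- The raw conditional estimator `R = R₁ - R₀`. -/
def R (ω : Sample N) : ℝ := rawCond true ω - rawCond false ω

/-- The term `M_{xz}` of the marginalisation estimator: the proportion of `Y = 1` among the
observations with `X = x`, `Z = z` (`0` if there are none), weighted by the proportion of
observations with `Z = z`. -/
def margTerm (x z : Bool) (ω : Sample N) : ℝ :=
  cnt x z true ω / cntXZ x z ω * ((cntXZ false z ω + cntXZ true z ω) / (N : ℝ))

/-- The marginalisation estimator `M = M₁ - M₀`, `M_x = M_{x1} + M_{x0}`. -/
def M (ω : Sample N) : ℝ :=
  (margTerm true true ω + margTerm true false ω)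
    - (margTerm false true ω + margTerm false false ω)

/-- The combined estimator `P(α) = α R + (1 - α) M`. -/
def P (α : ℝ) (ω : Sample N) : ℝ := α * R ω + (1 - α) * M ω

end Estimators

/-- `V[R]` for samples of size `N`. -/
def Params.varR (θ : Params) (N : ℕ) : ℝ := variance (R : Sample N → ℝ) (θ.sampleLaw N)

/-- `V[M]` for samples of size `N`. -/
def Params.varM (θ : Params) (N : ℕ) : ℝ := variance (M : Sample N → ℝ) (θ.sampleLaw N)

/-- `C[R, M]` for samples of size `N`. -/
def Params.covRM (θ : Params) (N : ℕ) : ℝ :=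
  covariance (R : Sample N → ℝ) (M : Sample N → ℝ) (θ.sampleLaw N)

/-- `V[P(α)]` for samples of size `N`. -/
def Params.varP (θ : Params) (N : ℕ) (α : ℝ) : ℝ :=
  variance (P α : Sample N → ℝ) (θ.sampleLaw N)

/-- The weight `α*`. -/
def Params.optWeight (θ : Params) (N : ℕ) : ℝ :=
  (θ.varM N - θ.covRM N) / ((θ.varR N - θ.covRM N) + (θ.varM N - θ.covRM N))

/-- The leading term of `(C[R, M] - V[R]) N`. -/
def leadR (pX pZ C D : ℝ) : ℝ :=
  -(pZ * (1 - pZ) / (pX * (1 - pX)) * (2 * C + (2 * pX - 1) * D) ^ 2)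

/-- The leading term of `(C[R, M] - V[M]) N`. -/
def leadM (pX q₀ q₁ : ℝ) (N : ℕ) : ℝ :=
  -(q₁ * (1 - q₁) * (1 - pX) / ((N : ℝ) * pX ^ 2))
    - q₀ * (1 - q₀) * pX / ((N : ℝ) * (1 - pX) ^ 2)

end VStructure

end

/-! Part (a) is a completed square. With `a = V[R] - C[R,M]` and `b = V[M] - C[R,M]` both positive,
`V[P(α)] = V[P(α*)] + (a + b) (α - α*)²`, and `α* = b / (a + b)` is neither 0 nor 1.

For (b), condition on the X- and Z-parts of the sample. Both estimators are then linear in the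
independent outcomes (`R_eq_sum`, `M_eq_sum`), so every covariance is the covariance of the
conditional means plus the mean of the conditional covariance. When no (X,Z) cell is empty, the
conditional biases are centred linear functions of the Z-part (`biasR_eq_linR`, `biasM_eq_linM`); an
empty cell has exponentially small probability (`pairExp_emptyCells`). Write `σ = pZ (1 - pZ)`,
`s_x` for the slope in z of the outcome probability, `v_xz` for the conditional variance of Y, and
`S = ∑ v_xz p(z) E[1/N_x]`. Up to exponentially small errors, `V[R] = σ ∑ s_x² E[1/N_x] + S`,
`C[R,M] = σ (s_1 - s_0)² / N + S`, `V[M] = σ (s_1 - s_0)² / N + ∑ v_xz E[(N_z/N)² / N_xz]`. So the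
covariance shares its outcome part with `V[R]` and its Z-part with `V[M]`, and each difference
isolates a single effect.

What remains is the mean of a reciprocal binomial, `1/(np) + (1-p)/(p²n²) + O(n⁻³)`
(`exists_binExp_inv_expansion`). Its first order suffices for `C[R,M] - V[R]`, where the slopes
combine to a negative square; in `C[R,M] - V[M]` the first order cancels and the second order
decides. The error bounds are uniform in the outcome probabilities, since these vary with N in the
scaling limit. -/

noncomputable section

namespace VStructure

/-- The expectation of `f` under independent Bernoulli variables with parameters `p i`. -/
def bexp {N : ℕ} (p : Fin N → ℝ) (f : (Fin N → Bool) → ℝ) : ℝ :=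
  ∑ y, (∏ i, bern (p i) (y i)) * f y

/-- The real value of a Boolean. -/
def ind (b : Bool) : ℝ := if b then 1 else 0

/-- The expectation of `φ` under the binomial distribution with parameters `n` and `p`. -/
def binExp (p : ℝ) : ℕ → (ℕ → ℝ) → ℝ
  | 0, φ => φ 0
  | n + 1, φ => p * binExp p n (fun k => φ (k + 1)) + (1 - p) * binExp p n φ

/-! ### Expectations over independent Bernoulli variables. -/

section BernoulliExpectation

variable {N : ℕ}

lemma bern_nonneg {p : ℝ} (hp : 0 ≤ p ∧ p ≤ 1) (b : Bool) : 0 ≤ bern p b := by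
  cases b <;> simp [bern] <;> linarith [hp.1, hp.2]

lemma bern_le_one {p : ℝ} (hp : 0 ≤ p ∧ p ≤ 1) (b : Bool) : bern p b ≤ 1 := by
  cases b <;> simp [bern] <;> linarith [hp.1, hp.2]

lemma bern_pos {p : ℝ} (hp : 0 < p ∧ p < 1) (b : Bool) : 0 < bern p b := by
  cases b <;> simp [bern] <;> linarith [hp.1, hp.2]

lemma bern_lt_one {p : ℝ} (hp : 0 < p ∧ p < 1) (b : Bool) : bern p b < 1 := by
  cases b <;> simp [bern] <;> linarith [hp.1, hp.2]

lemma bexp_zero (p : Fin 0 → ℝ) (f : (Fin 0 → Bool) → ℝ) : bexp p f = f Fin.elim0 := by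
  simp only [bexp, Finset.univ_eq_empty, Finset.prod_empty, one_mul]
  rw [Fintype.sum_unique]
  congr 1

lemma bexp_succ (p : Fin (N + 1) → ℝ) (f : (Fin (N + 1) → Bool) → ℝ) :
    bexp p f = p 0 * bexp (fun i => p i.succ) (fun y => f (Fin.cons true y))
      + (1 - p 0) * bexp (fun i => p i.succ) (fun y => f (Fin.cons false y)) := by
  simp only [bexp]
  rw [← (Fin.consEquiv fun _ => Bool).sum_comp, Fintype.sum_prod_type, Fintype.sum_bool]
  simp [Fin.consEquiv, Fin.prod_univ_succ, bern, Finset.mul_sum, mul_assoc]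

lemma bexp_add (p : Fin N → ℝ) (f g : (Fin N → Bool) → ℝ) :
    bexp p (fun y => f y + g y) = bexp p f + bexp p g := by
  simp [bexp, mul_add, Finset.sum_add_distrib]

lemma bexp_sub (p : Fin N → ℝ) (f g : (Fin N → Bool) → ℝ) :
    bexp p (fun y => f y - g y) = bexp p f - bexp p g := by
  simp [bexp, mul_sub, Finset.sum_sub_distrib]

lemma bexp_const_mul (p : Fin N → ℝ) (c : ℝ) (f : (Fin N → Bool) → ℝ) :
    bexp p (fun y => c * f y) = c * bexp p f := by
  simp only [bexp, Finset.mul_sum]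
  exact Finset.sum_congr rfl fun _ _ => by ring

lemma bexp_sum {ι : Type*} (s : Finset ι) (p : Fin N → ℝ) (f : ι → (Fin N → Bool) → ℝ) :
    bexp p (fun y => ∑ j ∈ s, f j y) = ∑ j ∈ s, bexp p (f j) := by
  simp only [bexp, Finset.mul_sum]
  exact Finset.sum_comm

lemma bexp_const (p : Fin N → ℝ) (c : ℝ) : bexp p (fun _ => c) = c := by
  induction N with
  | zero => rw [bexp_zero]
  | succ n ih => rw [bexp_succ, ih]; ring

lemma bexp_mono {p : Fin N → ℝ} (hp : ∀ i, 0 ≤ p i ∧ p i ≤ 1) {f g : (Fin N → Bool) → ℝ}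
    (h : ∀ y, f y ≤ g y) : bexp p f ≤ bexp p g :=
  Finset.sum_le_sum fun y _ => mul_le_mul_of_nonneg_left (h y)
    (Finset.prod_nonneg fun i _ => bern_nonneg (hp i) _)

lemma bexp_comm {p q : Fin N → ℝ} (f : (Fin N → Bool) → (Fin N → Bool) → ℝ) :
    bexp p (fun x => bexp q (f x)) = bexp q (fun z => bexp p (fun x => f x z)) := by
  simp only [bexp, Finset.mul_sum]
  rw [Finset.sum_comm]
  exact Finset.sum_congr rfl fun _ _ => Finset.sum_congr rfl fun _ _ => by ring

/-- The expectation of an affine function of independent Bernoulli variables. -/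
lemma bexp_affine (p a : Fin N → ℝ) (c : ℝ) :
    bexp p (fun y => ∑ i, a i * ind (y i) - c) = ∑ i, a i * p i - c := by
  induction N generalizing c with
  | zero => rw [bexp_zero]; simp
  | succ n ih =>
    rw [bexp_succ]
    simp only [Fin.sum_univ_succ, Fin.cons_zero, Fin.cons_succ]
    have h := ih (fun i => p i.succ) (fun i => a i.succ)
    -- A first coordinate equal to one shifts the centring constant by `a 0`, which is why the
    -- induction runs over all `c`.
    have h1 := h (c - a 0)
    have h0 := h c
    simp only [ind, if_true, mul_one, Bool.false_eq_true, if_false, mul_zero, zero_add] at *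
    simp only [show ∀ u, a 0 + u - c = u - (c - a 0) from fun u => by ring]
    rw [h1, h0]
    ring

/-- The mixed second moment of two affine functions of independent Bernoulli variables. -/
lemma bexp_affine_mul_affine (p a b : Fin N → ℝ) (c d : ℝ) :
    bexp p (fun y => (∑ i, a i * ind (y i) - c) * (∑ i, b i * ind (y i) - d))
      = (∑ i, a i * p i - c) * (∑ i, b i * p i - d) + ∑ i, a i * b i * (p i * (1 - p i)) := by
  induction N generalizing c d with
  | zero => rw [bexp_zero]; simp
  | succ n ih =>
    rw [bexp_succ]
    simp only [Fin.sum_univ_succ, Fin.cons_zero, Fin.cons_succ]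
    have h := ih (fun i => p i.succ) (fun i => a i.succ) (fun i => b i.succ)
    have h1 := h (c - a 0) (d - b 0)
    have h0 := h c d
    simp only [ind, if_true, mul_one, Bool.false_eq_true, if_false, mul_zero, zero_add] at *
    simp only [show ∀ u, a 0 + u - c = u - (c - a 0) from fun u => by ring,
      show ∀ u, b 0 + u - d = u - (d - b 0) from fun u => by ring]
    rw [h1, h0]
    ring

/-- Coordinates outside `S` integrate out, and each coordinate in `S` is one step of the recursion
defining `binExp`. This turns every cell count into a binomial variable. -/
lemma bexp_card_filter (p : ℝ) (b : Bool) (S : Fin N → Prop) [DecidablePred S] (φ : ℕ → ℝ) :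
    bexp (fun _ => p) (fun x => φ (Finset.univ.filter fun i => x i = b ∧ S i).card)
      = binExp (bern p b) (Finset.univ.filter S).card φ := by
  induction N generalizing φ with
  | zero => rw [bexp_zero]; simp [binExp]
  | succ n ih =>
    rw [bexp_succ]
    simp only [Fin.card_filter_univ_succ, Fin.cons_zero, Fin.cons_succ]
    have h := ih (fun i => S i.succ)
    by_cases hS : S 0
    · have h1 := h (fun k => φ (k + 1))
      have h0 := h φ
      cases b <;> simp [hS, binExp, bern] at * <;> rw [h1, h0]
      ring
    · have h0 := h φ
      simp [hS] at *
      rw [h0]; ring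

end BernoulliExpectation

/-! ### Reciprocal moments of the binomial distribution. -/

section Binomial

lemma binExp_congr {p : ℝ} {n : ℕ} {φ ψ : ℕ → ℝ} (h : ∀ k, φ k = ψ k) :
    binExp p n φ = binExp p n ψ := by rw [funext h]

lemma binExp_add (p : ℝ) (n : ℕ) (φ ψ : ℕ → ℝ) :
    binExp p n (fun k => φ k + ψ k) = binExp p n φ + binExp p n ψ := by
  induction n generalizing φ ψ with
  | zero => rfl
  | succ n ih => simp only [binExp]; rw [ih, ih]; ring

lemma binExp_const_mul (p : ℝ) (n : ℕ) (c : ℝ) (φ : ℕ → ℝ) :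
    binExp p n (fun k => c * φ k) = c * binExp p n φ := by
  induction n generalizing φ with
  | zero => rfl
  | succ n ih => simp only [binExp]; rw [ih, ih]; ring

lemma binExp_const (p : ℝ) (n : ℕ) (c : ℝ) : binExp p n (fun _ => c) = c := by
  induction n with
  | zero => rfl
  | succ n ih => simp only [binExp]; rw [ih]; ring

lemma binExp_mono {p : ℝ} (hp : 0 ≤ p ∧ p ≤ 1) {n : ℕ} {φ ψ : ℕ → ℝ} (h : ∀ k, φ k ≤ ψ k) :
    binExp p n φ ≤ binExp p n ψ := by
  induction n generalizing φ ψ with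
  | zero => exact h 0
  | succ n ih =>
    simp only [binExp]
    exact add_le_add (mul_le_mul_of_nonneg_left (ih fun k => h _) hp.1)
      (mul_le_mul_of_nonneg_left (ih h) (by linarith [hp.2]))

lemma binExp_abs_sub_le {p : ℝ} (hp : 0 ≤ p ∧ p ≤ 1) {n : ℕ} {φ ψ χ : ℕ → ℝ}
    (h : ∀ k, |φ k - ψ k| ≤ χ k) : |binExp p n φ - binExp p n ψ| ≤ binExp p n χ := by
  have h1 := binExp_mono hp (n := n) (φ := φ) (ψ := fun k => ψ k + χ k)
    (fun k => by linarith [(abs_le.1 (h k)).2])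
  have h2 := binExp_mono hp (n := n) (φ := ψ) (ψ := fun k => φ k + χ k)
    (fun k => by linarith [(abs_le.1 (h k)).1])
  rw [binExp_add] at h1 h2
  exact abs_le.2 ⟨by linarith, by linarith⟩

/-- The size-bias identity for the binomial distribution. -/
lemma binExp_sizeBias (p : ℝ) (n : ℕ) (φ : ℕ → ℝ) :
    binExp p (n + 1) (fun k => k * φ k) = (n + 1) * p * binExp p n (fun k => φ (k + 1)) := by
  induction n generalizing φ with
  | zero => simp [binExp]
  | succ n ih =>
    rw [binExp]
    have h1 : binExp p (n + 1) (fun k => ((k + 1 : ℕ) : ℝ) * φ (k + 1))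
        = binExp p (n + 1) (fun k => k * φ (k + 1)) + binExp p (n + 1) (fun k => φ (k + 1)) := by
      rw [← binExp_add]
      exact binExp_congr fun k => by push_cast; ring
    rw [h1, ih, ih, show binExp p (n + 1) (fun k => φ (k + 1))
      = p * binExp p n (fun k => φ (k + 1 + 1))
        + (1 - p) * binExp p n (fun k => φ (k + 1)) from rfl]
    push_cast
    ring

lemma binExp_id (p : ℝ) (n : ℕ) : binExp p n (fun k => (k : ℝ)) = n * p := by
  cases n with
  | zero => simp [binExp]
  | succ n =>
    have h := binExp_sizeBias p n (fun _ => 1)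
    simp only [mul_one, binExp_const] at h
    rw [h]; push_cast; ring

lemma binExp_pow (p r : ℝ) (n : ℕ) : binExp p n (fun k => r ^ k) = (1 - p + p * r) ^ n := by
  induction n with
  | zero => simp [binExp]
  | succ n ih =>
    have h : binExp p n (fun k => r ^ (k + 1)) = r * binExp p n (fun k => r ^ k) := by
      rw [← binExp_const_mul]; exact binExp_congr fun k => by ring
    rw [binExp, h, ih]; ring

lemma binExp_eq_zero (p : ℝ) (n : ℕ) :
    binExp p n (fun k => if k = 0 then 1 else 0) = (1 - p) ^ n := by
  induction n with
  | zero => simp [binExp]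
  | succ n ih => rw [binExp, ih]; simp [binExp_const]; ring

/-- Size bias applied to `1/k`: the product `k * (1/k)` is 1 except at `k = 0`, where it vanishes,
so only the mass at zero has to be subtracted. -/
lemma binExp_inv_add_one {p : ℝ} (hp : 0 < p) (n : ℕ) :
    binExp p n (fun k => 1 / ((k : ℝ) + 1)) = (1 - (1 - p) ^ (n + 1)) / ((n + 1) * p) := by
  have h := binExp_sizeBias p n (fun k => 1 / (k : ℝ))
  have h1 : binExp p (n + 1) (fun k => k * (1 / (k : ℝ))) = 1 - (1 - p) ^ (n + 1) := by
    rw [← binExp_eq_zero, eq_sub_iff_add_eq, ← binExp_add]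
    refine Eq.trans ?_ (binExp_const p (n + 1) 1)
    refine binExp_congr fun k => ?_
    rcases Nat.eq_zero_or_pos k with rfl | hk
    · simp
    · have : (k : ℝ) ≠ 0 := by positivity
      simp [this, hk.ne']
  rw [h1] at h
  rw [eq_div_iff (by positivity), h]
  push_cast
  ring

lemma binExp_inv_add_one_le {p : ℝ} (hp : 0 < p ∧ p < 1) (n : ℕ) :
    binExp p n (fun k => 1 / ((k : ℝ) + 1)) ≤ 1 / ((n + 1) * p) := by
  rw [binExp_inv_add_one hp.1]
  have := hp.1
  gcongr
  linarith [pow_nonneg (sub_nonneg.2 hp.2.le) (n + 1)]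

/-- Size bias applied to `1/(k(k+1))`. The product with `k` is `1/(k+1)` except at `k = 0`, which
accounts for the extra term `(1-p)^(n+1)`. -/
lemma binExp_inv_add_one_add_two {p : ℝ} (hp : 0 < p) (n : ℕ) :
    binExp p n (fun k => 1 / (((k : ℝ) + 1) * (k + 2)))
      = ((1 - (1 - p) ^ (n + 2)) / ((n + 2) * p) - (1 - p) ^ (n + 1)) / ((n + 1) * p) := by
  have h := binExp_sizeBias p n (fun k => 1 / ((k : ℝ) * (k + 1)))
  have h1 : binExp p (n + 1) (fun k => k * (1 / ((k : ℝ) * (k + 1))))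
      = (1 - (1 - p) ^ (n + 2)) / ((n + 2) * p) - (1 - p) ^ (n + 1) := by
    have h2 := binExp_inv_add_one hp (n + 1)
    push_cast at h2
    rw [add_assoc (n : ℝ) 1 1, show (1 : ℝ) + 1 = 2 by norm_num] at h2
    rw [← binExp_eq_zero p (n + 1), show n + 2 = n + 1 + 1 from rfl, ← h2, eq_sub_iff_add_eq,
      ← binExp_add]
    refine binExp_congr fun k => ?_
    rcases Nat.eq_zero_or_pos k with rfl | hk
    · simp
    · have : (k : ℝ) ≠ 0 := by positivity
      simp only [hk.ne', if_false, add_zero]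
      field_simp
  rw [h1] at h
  rw [eq_div_iff (by positivity), h, mul_comm]
  congr 1
  exact binExp_congr fun k => by push_cast; ring_nf

lemma binExp_inv_add_one_add_two_le {p : ℝ} (hp : 0 < p ∧ p < 1) (n : ℕ) :
    binExp p n (fun k => 1 / (((k : ℝ) + 1) * (k + 2))) ≤ 1 / ((n + 1) * (n + 2) * p ^ 2) := by
  rw [binExp_inv_add_one_add_two hp.1]
  have h0 := hp.1
  have h1 := pow_nonneg (sub_nonneg.2 hp.2.le) (n + 1)
  have h2 := pow_nonneg (sub_nonneg.2 hp.2.le) (n + 2)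
  calc _ ≤ (1 / ((n + 2) * p)) / ((n + 1) * p) := by
        gcongr
        have : (1 - (1 - p) ^ (n + 2)) / ((n + 2) * p) ≤ 1 / ((n + 2) * p) := by
          gcongr; linarith
        linarith
    _ = _ := by field_simp

lemma binExp_inv_add_one_add_two_add_three_le {p : ℝ} (hp : 0 < p ∧ p < 1) (n : ℕ) :
    binExp p n (fun k => 1 / (((k : ℝ) + 1) * (k + 2) * (k + 3)))
      ≤ 1 / ((n + 1) * (n + 2) * (n + 3) * p ^ 3) := by
  have h0 := hp.1
  have h := binExp_sizeBias p n (fun k => 1 / ((k : ℝ) * (k + 1) * (k + 2)))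
  have h1 : binExp p (n + 1) (fun k => k * (1 / ((k : ℝ) * (k + 1) * (k + 2))))
      ≤ 1 / ((n + 2) * (n + 3) * p ^ 2) := by
    have h2 := binExp_inv_add_one_add_two_le hp (n + 1)
    push_cast at h2
    rw [add_assoc (n : ℝ) 1 1, add_assoc (n : ℝ) 1 2, show (1 : ℝ) + 1 = 2 by norm_num,
      show (1 : ℝ) + 2 = 3 by norm_num] at h2
    refine le_trans (binExp_mono ⟨h0.le, hp.2.le⟩ fun k => ?_) h2
    rcases Nat.eq_zero_or_pos k with rfl | hk
    · simp
    · have : (k : ℝ) ≠ 0 := by positivity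
      apply le_of_eq
      field_simp
  rw [h] at h1
  have h3 : binExp p n (fun k => 1 / ((((k + 1 : ℕ) : ℝ)) * (((k + 1 : ℕ) : ℝ) + 1)
      * (((k + 1 : ℕ) : ℝ) + 2))) = binExp p n (fun k => 1 / (((k : ℝ) + 1) * (k + 2) * (k + 3))) :=
    binExp_congr fun k => by push_cast; ring_nf
  rw [h3] at h1
  have h4 : (0 : ℝ) < (n + 1) * p := by positivity
  rw [← mul_le_mul_iff_right₀ h4]
  refine h1.trans (le_of_eq ?_)
  field_simp

/-- The first two terms of the inverse factorial series of `1/k`, whose binomial means are explicit.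
For `k ≥ 1` the remainder is `2/(k(k+1)(k+2))`. The constant 9 is forced by `k = 0`, where `1/0 = 0`
and both sides equal 3/2. -/
lemma abs_inv_sub_le (k : ℕ) :
    |1 / (k : ℝ) - (1 / ((k : ℝ) + 1) + 1 / (((k : ℝ) + 1) * (k + 2)))|
      ≤ 9 * (1 / (((k : ℝ) + 1) * (k + 2) * (k + 3))) := by
  rcases Nat.eq_zero_or_pos k with rfl | hk
  · norm_num
  · have h1 : (1 : ℝ) ≤ k := by exact_mod_cast hk
    have h0 : (0 : ℝ) < k := by linarith
    have : 1 / (k : ℝ) - (1 / ((k : ℝ) + 1) + 1 / (((k : ℝ) + 1) * (k + 2)))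
        = 2 / (k * (k + 1) * (k + 2)) := by field_simp; ring
    rw [this, abs_of_nonneg (by positivity), mul_one_div, div_le_div_iff₀ (by positivity)
      (by positivity)]
    have : (0 : ℝ) < (k + 1) * (k + 2) := by positivity
    nlinarith

/-- The second order expansion of the mean of the reciprocal of a binomial variable. -/
lemma exists_binExp_inv_expansion {p : ℝ} (hp : 0 < p ∧ p < 1) :
    ∃ K : ℝ, 0 ≤ K ∧ ∀ n : ℕ,
      |(n : ℝ) ^ 2 * binExp p n (fun k => 1 / (k : ℝ)) - (n / p + (1 - p) / p ^ 2)|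
        ≤ K * (1 / ((n : ℝ) + 1)) := by
  have h0 := hp.1
  have hq : 0 ≤ 1 - p := by linarith [hp.2]
  -- Polynomial times exponential decay is bounded; this controls the contributions of the binomial
  -- variable being zero.
  have hlim := tendsto_pow_const_mul_const_pow_of_abs_lt_one 3
    (show |1 - p| < 1 by rw [abs_of_nonneg hq]; linarith)
  obtain ⟨Q, hQ⟩ := hlim.bddAbove_range
  have hQ' : ∀ n : ℕ, (n : ℝ) ^ 3 * (1 - p) ^ n ≤ Q := fun n => hQ ⟨n, rfl⟩
  have hQ0 : 0 ≤ Q := by simpa using hQ' 0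
  refine ⟨1 / p + 3 / p ^ 2 + 2 * (Q / p) + Q / p ^ 2 + 9 / p ^ 3, by positivity, fun n => ?_⟩
  have hn1 : (0 : ℝ) < (n : ℝ) + 1 := by positivity
  set T : ℝ := (n : ℝ) ^ 2 * (1 - p) ^ (n + 1) with hT
  have hT0 : 0 ≤ T := by positivity
  have hTQ : T ≤ Q := by
    refine le_trans ?_ (hQ' n)
    rcases Nat.eq_zero_or_pos n with rfl | hn
    · simp [hT]
    · have h1 : (1 : ℝ) ≤ n := by exact_mod_cast hn
      have h2 : (0 : ℝ) ≤ (1 - p) ^ n := by positivity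
      rw [hT, pow_succ (1 - p), pow_succ (n : ℝ) 2, mul_assoc]
      have h3 : (1 - p) ^ n * (1 - p) ≤ n * (1 - p) ^ n := by nlinarith
      nlinarith [sq_nonneg (n : ℝ)]
  have hmain := binExp_abs_sub_le ⟨h0.le, hp.2.le⟩ (n := n) abs_inv_sub_le
  rw [binExp_add, binExp_const_mul, binExp_inv_add_one h0, binExp_inv_add_one_add_two h0] at hmain
  have hrem := binExp_inv_add_one_add_two_add_three_le hp n
  set a := binExp p n (fun k => 1 / (k : ℝ))
  set b := (1 - (1 - p) ^ (n + 1)) / (((n : ℝ) + 1) * p)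
    + ((1 - (1 - p) ^ (n + 2)) / (((n : ℝ) + 2) * p) - (1 - p) ^ (n + 1)) / (((n : ℝ) + 1) * p)
    with hb
  -- Exact error of the two-term approximation, with the factor `1/(n+1)` taken out; the remaining
  -- factor is bounded in `n`.
  have hid : (n : ℝ) ^ 2 * b - (n / p + (1 - p) / p ^ 2)
      = (1 / p - (3 * n + 2) / (n + 2) / p ^ 2 - 2 * (T / p)
        - T * ((1 - p) / (n + 2)) / p ^ 2) * (1 / ((n : ℝ) + 1)) := by
    rw [hb, hT]
    field_simp
    ring
  have hX : |1 / p - (3 * n + 2) / (n + 2) / p ^ 2 - 2 * (T / p)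
        - T * ((1 - p) / (n + 2)) / p ^ 2| ≤ 1 / p + 3 / p ^ 2 + 2 * (Q / p) + Q / p ^ 2 := by
    have e1 : 0 ≤ 1 / p := by positivity
    have e2 : (0 : ℝ) ≤ (3 * n + 2) / (n + 2) / p ^ 2 := by positivity
    have e2' : (3 * (n : ℝ) + 2) / (n + 2) / p ^ 2 ≤ 3 / p ^ 2 := by
      gcongr
      rw [div_le_iff₀ (by positivity)]
      linarith
    have e3 : 0 ≤ T / p := by positivity
    have e3' : T / p ≤ Q / p := by gcongr
    have e4 : 0 ≤ T * ((1 - p) / (n + 2)) / p ^ 2 := by positivity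
    have e4' : T * ((1 - p) / (n + 2)) / p ^ 2 ≤ Q / p ^ 2 := by
      gcongr
      have : (1 - p) / ((n : ℝ) + 2) ≤ 1 := by
        rw [div_le_one (by positivity)]
        linarith [(Nat.cast_nonneg n : (0 : ℝ) ≤ n)]
      calc T * ((1 - p) / (n + 2)) ≤ T * 1 := by gcongr
        _ ≤ Q := by linarith
    have e5 : 0 ≤ 3 / p ^ 2 := by positivity
    have e6 : 0 ≤ Q / p ^ 2 := by positivity
    have e7 : 0 ≤ Q / p := by positivity
    rw [abs_le]
    constructor <;> linarith
  have hR : |(n : ℝ) ^ 2 * a - (n : ℝ) ^ 2 * b| ≤ 9 / p ^ 3 * (1 / ((n : ℝ) + 1)) := by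
    rw [← mul_sub, abs_mul, abs_of_nonneg (by positivity : (0 : ℝ) ≤ (n : ℝ) ^ 2)]
    calc (n : ℝ) ^ 2 * |a - b|
        ≤ n ^ 2 * (9 * (1 / (((n : ℝ) + 1) * (n + 2) * (n + 3) * p ^ 3))) := by
          gcongr
          linarith
      _ = (n ^ 2 / ((n + 2) * (n + 3))) * (9 / p ^ 3 * (1 / ((n : ℝ) + 1))) := by
          field_simp
      _ ≤ 1 * (9 / p ^ 3 * (1 / ((n : ℝ) + 1))) := by
          gcongr
          rw [div_le_one (by positivity)]
          nlinarith [(Nat.cast_nonneg n : (0 : ℝ) ≤ n)]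
      _ = _ := one_mul _
  have hfin : |(n : ℝ) ^ 2 * b - (n / p + (1 - p) / p ^ 2)|
      ≤ (1 / p + 3 / p ^ 2 + 2 * (Q / p) + Q / p ^ 2) * (1 / ((n : ℝ) + 1)) := by
    rw [hid, abs_mul, abs_of_pos (by positivity : (0 : ℝ) < 1 / ((n : ℝ) + 1))]
    gcongr
  calc _ ≤ _ := abs_sub_le _ ((n : ℝ) ^ 2 * b) _
    _ ≤ _ := add_le_add hR hfin
    _ = _ := by ring

end Binomial

/-! ### The law of the sample, and the optimal weight. -/

section SampleLaw

variable {θ : Params} {N : ℕ}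

/-- The expectation of `f` over samples of size `N`, as an iterated Bernoulli expectation. -/
def Params.sampleExp (θ : Params) (N : ℕ) (f : Sample N → ℝ) : ℝ :=
  bexp (fun _ => θ.pX) fun x => bexp (fun _ => θ.pZ) fun z =>
    bexp (fun i => θ.pY (x i) (z i)) fun y => f fun i => (x i, z i, y i)

lemma Params.Valid.pX_mem (h : θ.Valid) : 0 ≤ θ.pX ∧ θ.pX ≤ 1 := ⟨h.1.1.le, h.1.2.le⟩

lemma Params.Valid.pZ_mem (h : θ.Valid) : 0 ≤ θ.pZ ∧ θ.pZ ≤ 1 := ⟨h.2.1.1.le, h.2.1.2.le⟩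

lemma Params.Valid.prob_nonneg (h : θ.Valid) (a : Obs) : 0 ≤ θ.prob a :=
  mul_nonneg (mul_nonneg (bern_nonneg h.pX_mem _) (bern_nonneg h.pZ_mem _))
    (bern_nonneg (h.2.2 _ _) _)

lemma Params.obsLaw_singleton (θ : Params) (a : Obs) :
    θ.obsLaw {a} = ENNReal.ofReal (θ.prob a) := by
  rw [Params.obsLaw, Measure.finsetSum_apply]
  simp only [Measure.smul_apply, smul_eq_mul, Measure.dirac_apply, Set.indicator_apply,
    Set.mem_singleton_iff, Pi.one_apply]
  simp

lemma Params.Valid.isProbabilityMeasure_obsLaw (h : θ.Valid) :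
    IsProbabilityMeasure θ.obsLaw := by
  refine ⟨?_⟩
  rw [Params.obsLaw, Measure.finsetSum_apply]
  simp only [Measure.smul_apply, smul_eq_mul, measure_univ, mul_one]
  rw [← ENNReal.ofReal_sum_of_nonneg fun a _ => h.prob_nonneg a, ENNReal.ofReal_eq_one]
  simp only [Fintype.sum_prod_type, Fintype.sum_bool, Params.prob, bern]
  simp only [if_true, Bool.false_eq_true, if_false]
  ring

lemma Params.Valid.isProbabilityMeasure_sampleLaw (h : θ.Valid) (N : ℕ) :
    IsProbabilityMeasure (θ.sampleLaw N) := by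
  have := h.isProbabilityMeasure_obsLaw
  unfold Params.sampleLaw
  infer_instance

/-- The mass of a sample is a product over observations, so splitting the sample into its X-, Z- and
Y-vectors gives nested Bernoulli expectations. With Y innermost, conditioning on X and Z amounts to
evaluating the inner expectation. -/
lemma Params.Valid.integral_sampleLaw (h : θ.Valid) (f : Sample N → ℝ) :
    ∫ ω, f ω ∂(θ.sampleLaw N) = θ.sampleExp N f := by
  have := h.isProbabilityMeasure_obsLaw
  have := h.isProbabilityMeasure_sampleLaw N
  rw [integral_fintype .of_finite]
  have hsing : ∀ ω : Sample N, (θ.sampleLaw N).real {ω} = ∏ i, θ.prob (ω i) := fun ω => by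
    rw [Measure.real, Params.sampleLaw, Measure.pi_singleton, ENNReal.toReal_prod]
    exact Finset.prod_congr rfl fun i _ => by
      rw [θ.obsLaw_singleton, ENNReal.toReal_ofReal (h.prob_nonneg _)]
  simp only [hsing, smul_eq_mul]
  rw [← (Equiv.arrowProdEquivProdArrow (Fin N) (fun _ => Bool)
      (fun _ => Bool × Bool)).symm.sum_comp,
    Fintype.sum_prod_type]
  simp only [Params.sampleExp, bexp, Finset.mul_sum]
  refine Finset.sum_congr rfl fun x _ => ?_
  rw [← (Equiv.arrowProdEquivProdArrow (Fin N) (fun _ => Bool) (fun _ => Bool)).symm.sum_comp,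
    Fintype.sum_prod_type]
  refine Finset.sum_congr rfl fun z _ => Finset.sum_congr rfl fun y _ => ?_
  simp only [Equiv.arrowProdEquivProdArrow, Equiv.coe_fn_symm_mk, Params.prob,
    Finset.prod_mul_distrib]
  ring

lemma Params.Valid.memLp (h : θ.Valid) (f : Sample N → ℝ) : MemLp f 2 (θ.sampleLaw N) := by
  have := h.isProbabilityMeasure_sampleLaw N
  exact MemLp.of_discrete

/-- The covariance of two statistics does not depend on the point at which they are centred. -/
lemma Params.Valid.covariance_eq (h : θ.Valid) (f g : Sample N → ℝ) (c d : ℝ) :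
    covariance f g (θ.sampleLaw N)
      = θ.sampleExp N (fun ω => (f ω - c) * (g ω - d))
        - θ.sampleExp N (fun ω => f ω - c) * θ.sampleExp N (fun ω => g ω - d) := by
  have := h.isProbabilityMeasure_sampleLaw N
  simp only [← h.integral_sampleLaw]
  rw [← covariance_sub_const_left ((h.memLp f).integrable (by norm_num)) c,
    ← covariance_sub_const_right ((h.memLp g).integrable (by norm_num)) d,
    covariance_eq_sub (h.memLp _) (h.memLp _)]
  rfl

lemma Params.Valid.varR_eq (h : θ.Valid) :
    θ.varR N = covariance (R : Sample N → ℝ) R (θ.sampleLaw N) :=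
  (covariance_self (h.memLp _).aemeasurable).symm

lemma Params.Valid.varM_eq (h : θ.Valid) :
    θ.varM N = covariance (M : Sample N → ℝ) M (θ.sampleLaw N) :=
  (covariance_self (h.memLp _).aemeasurable).symm

lemma Params.Valid.varP_eq (h : θ.Valid) (α : ℝ) :
    θ.varP N α = α ^ 2 * θ.varR N + 2 * α * (1 - α) * θ.covRM N + (1 - α) ^ 2 * θ.varM N := by
  have := h.isProbabilityMeasure_sampleLaw N
  have hP : (P α : Sample N → ℝ) = (fun ω => α * R ω) + fun ω => (1 - α) * M ω := rfl
  rw [Params.varP, hP, variance_add (h.memLp _) (h.memLp _), variance_const_mul,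
    variance_const_mul, covariance_const_mul_left, covariance_const_mul_right, Params.varR,
    Params.varM, Params.covRM]
  ring

/-- If the covariance is below both variances, `α*` minimises `V[P(α)]` and improves strictly on
both estimators. -/
lemma Params.Valid.varP_optWeight (h : θ.Valid)
    (hlt : θ.covRM N < min (θ.varR N) (θ.varM N)) :
    (∀ α : ℝ, θ.varP N (θ.optWeight N) ≤ θ.varP N α) ∧
      θ.varP N (θ.optWeight N) < min (θ.varR N) (θ.varM N) := by
  obtain ⟨hR, hM⟩ := lt_min_iff.1 hlt
  set a := θ.varR N - θ.covRM N with ha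
  set b := θ.varM N - θ.covRM N with hb
  have ha0 : 0 < a := sub_pos.2 hR
  have hb0 : 0 < b := sub_pos.2 hM
  have hα : θ.optWeight N = b / (a + b) := rfl
  have hab : a + b ≠ 0 := by positivity
  -- Completing the square in `α`; the minimiser is `b / (a + b)`.
  have hval : ∀ α, θ.varP N α
      = θ.varP N (θ.optWeight N) + (a + b) * (α - b / (a + b)) ^ 2 := fun α => by
    rw [h.varP_eq, h.varP_eq, hα, show θ.varR N = a + θ.covRM N by rw [ha]; ring,
      show θ.varM N = b + θ.covRM N by rw [hb]; ring]
    field_simp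
    ring
  refine ⟨fun α => ?_, lt_min ?_ ?_⟩
  · rw [hval α]
    have : 0 ≤ (a + b) * (α - b / (a + b)) ^ 2 := by positivity
    linarith
  · have h1 := hval 1
    rw [h.varP_eq 1] at h1
    have : 0 < (a + b) * (1 - b / (a + b)) ^ 2 := by
      rw [show 1 - b / (a + b) = a / (a + b) by field_simp; ring]
      positivity
    linarith
  · have h1 := hval 0
    rw [h.varP_eq 0] at h1
    have : 0 < (a + b) * (0 - b / (a + b)) ^ 2 := by
      rw [zero_sub, neg_sq]
      positivity
    linarith

end SampleLaw

/-- The sign with which the arm `X = x` enters the effect of `X` on `Y`. -/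
def sgn (x : Bool) : ℝ := if x then 1 else -1

lemma sgn_mul_self (x : Bool) : sgn x * sgn x = 1 := by cases x <;> norm_num [sgn]

lemma abs_sgn (x : Bool) : |sgn x| = 1 := by cases x <;> norm_num [sgn]

/-! ### Cell counts and empty cells. -/

section Counts

variable {N : ℕ}

/-- The number of coordinates equal to `x`. -/
def cntOne (x : Bool) (xs : Fin N → Bool) : ℕ := (Finset.univ.filter fun i => xs i = x).card

/-- The number of indices at which the coordinates are `x` and `z`. -/
def cntPair (x z : Bool) (xs zs : Fin N → Bool) : ℕ :=
  (Finset.univ.filter fun i => xs i = x ∧ zs i = z).card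

lemma sum_pair_mul (xs zs : Fin N → Bool) (w : Fin N → ℝ) (φ : Bool → Bool → ℝ) :
    ∑ i, φ (xs i) (zs i) * w i
      = ∑ x, ∑ z, (∑ i, if xs i = x ∧ zs i = z then w i else 0) * φ x z := by
  simp only [Fintype.sum_bool, Finset.sum_mul, ← Finset.sum_add_distrib]
  refine Finset.sum_congr rfl fun i _ => ?_
  cases xs i <;> cases zs i <;> simp [mul_comm]

lemma sum_pair (xs zs : Fin N → Bool) (φ : Bool → Bool → ℝ) :
    ∑ i, φ (xs i) (zs i) = ∑ x, ∑ z, cntPair x z xs zs * φ x z := by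
  have h := sum_pair_mul xs zs (fun _ => 1) φ
  simp only [mul_one] at h
  rw [h]
  simp [cntPair]

lemma sum_one (xs : Fin N → Bool) (φ : Bool → ℝ) :
    ∑ i, φ (xs i) = ∑ x, cntOne x xs * φ x := by
  have : ∀ i, φ (xs i) = ∑ x, (if xs i = x then 1 else 0) * φ x := fun i => by simp
  simp only [this]
  rw [Finset.sum_comm]
  refine Finset.sum_congr rfl fun x _ => ?_
  rw [← Finset.sum_mul]
  simp [cntOne]

lemma cntOne_fst (x : Bool) (xs zs : Fin N → Bool) :
    (cntOne x xs : ℝ) = cntPair x false xs zs + cntPair x true xs zs := by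
  have h := sum_pair xs zs (fun a _ => if a = x then 1 else 0)
  have h' := sum_one xs (fun a => if a = x then 1 else 0)
  rw [h] at h'
  cases x <;> simp at h' <;> linarith

lemma cntOne_snd (z : Bool) (xs zs : Fin N → Bool) :
    (cntOne z zs : ℝ) = cntPair false z xs zs + cntPair true z xs zs := by
  have h := sum_pair xs zs (fun _ a => if a = z then 1 else 0)
  have h' := sum_one zs (fun a => if a = z then 1 else 0)
  rw [h] at h'
  cases z <;> simp at h' <;> linarith

lemma cntOne_total (xs : Fin N → Bool) : (N : ℝ) = cntOne false xs + cntOne true xs := by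
  have h := sum_one xs (fun _ => 1)
  simp at h
  linarith

/-- The number of cells of the `(X, Z)` table without an observation. -/
def emptyCells (xs zs : Fin N → Bool) : ℝ :=
  ∑ x, ∑ z, if cntPair x z xs zs = 0 then 1 else 0

lemma emptyCells_nonneg (xs zs : Fin N → Bool) : 0 ≤ emptyCells xs zs :=
  Finset.sum_nonneg fun _ _ => Finset.sum_nonneg fun _ _ => by split_ifs <;> norm_num

/-- Makes `emptyCells` a majorant of the indicator of the exceptional event, so that its mean is a
union bound. -/
lemma pos_or_one_le_emptyCells (xs zs : Fin N → Bool) :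
    (∀ x z, (0 : ℝ) < cntPair x z xs zs) ∨ 1 ≤ emptyCells xs zs := by
  by_cases h : ∀ x z, cntPair x z xs zs ≠ 0
  · exact Or.inl fun x z => Nat.cast_pos.2 (Nat.pos_of_ne_zero (h x z))
  · push Not at h
    obtain ⟨x, z, hxz⟩ := h
    right
    have h1 : (1 : ℝ) ≤ ∑ z, if cntPair x z xs zs = 0 then 1 else 0 := by
      refine le_trans (by simp [hxz]) (Finset.single_le_sum
        (f := fun z => if cntPair x z xs zs = 0 then (1 : ℝ) else 0)
        (fun z _ => by positivity) (Finset.mem_univ z))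
    exact h1.trans (Finset.single_le_sum
        (f := fun x => ∑ z, if cntPair x z xs zs = 0 then (1 : ℝ) else 0)
        (fun z _ => by positivity) (Finset.mem_univ x))

/-- Two bounded quantities that agree when every cell is occupied. -/
lemma abs_sub_le_emptyCells {xs zs : Fin N → Bool} {a b K : ℝ}
    (h : (∀ x z, (0 : ℝ) < cntPair x z xs zs) → a = b) (ha : |a| ≤ K) (hb : |b| ≤ K) :
    |a - b| ≤ 2 * K * emptyCells xs zs := by
  have hK : 0 ≤ K := (abs_nonneg a).trans ha
  have h0 := emptyCells_nonneg xs zs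
  rcases pos_or_one_le_emptyCells xs zs with hp | h1
  · rw [h hp, sub_self, abs_zero]; positivity
  · calc |a - b| ≤ |a| + |b| := abs_sub _ _
      _ ≤ 2 * K * 1 := by linarith
      _ ≤ _ := by gcongr

lemma abs_sum_sum_bool_le {t : Bool → Bool → ℝ} {K : ℝ} (h : ∀ x z, |t x z| ≤ K) :
    |∑ x, ∑ z, t x z| ≤ 4 * K := by
  refine (Finset.abs_sum_le_sum_abs _ _).trans ?_
  refine (Finset.sum_le_sum fun x _ => (Finset.abs_sum_le_sum_abs _ _).trans
    (Finset.sum_le_sum fun z _ => h x z)).trans ?_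
  simp
  linarith

lemma cntPair_div_cntOne_fst_mem (x z : Bool) (xs zs : Fin N → Bool) :
    0 ≤ (cntPair x z xs zs : ℝ) / cntOne x xs ∧ (cntPair x z xs zs : ℝ) / cntOne x xs ≤ 1 := by
  refine ⟨by positivity, div_le_one_of_le₀ ?_ (by positivity)⟩
  rw [cntOne_fst x xs zs]
  cases z <;> simp

lemma cntOne_div_mem (x : Bool) (xs : Fin N → Bool) :
    0 ≤ (cntOne x xs : ℝ) / N ∧ (cntOne x xs : ℝ) / N ≤ 1 := by
  refine ⟨by positivity, div_le_one_of_le₀ ?_ (by positivity)⟩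
  rw [cntOne_total xs]
  cases x <;> simp

end Counts

/-! ### Expectations over the X- and Z-parts. -/

section PairExpectation

variable {N : ℕ} {p q : ℝ}

/-- The expectation of a function of the `X`- and `Z`-parts of a sample of size `N`. -/
def pairExp (p q : ℝ) (N : ℕ) (f : (Fin N → Bool) → (Fin N → Bool) → ℝ) : ℝ :=
  bexp (fun _ => p) fun x => bexp (fun _ => q) fun z => f x z

lemma pairExp_add (f g : (Fin N → Bool) → (Fin N → Bool) → ℝ) :
    pairExp p q N (fun x z => f x z + g x z) = pairExp p q N f + pairExp p q N g := by
  simp only [pairExp, bexp_add]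

lemma pairExp_sub (f g : (Fin N → Bool) → (Fin N → Bool) → ℝ) :
    pairExp p q N (fun x z => f x z - g x z) = pairExp p q N f - pairExp p q N g := by
  simp only [pairExp, bexp_sub]

lemma pairExp_const_mul (c : ℝ) (f : (Fin N → Bool) → (Fin N → Bool) → ℝ) :
    pairExp p q N (fun x z => c * f x z) = c * pairExp p q N f := by
  simp only [pairExp, bexp_const_mul]

lemma pairExp_sum {ι : Type*} (s : Finset ι) (f : ι → (Fin N → Bool) → (Fin N → Bool) → ℝ) :
    pairExp p q N (fun x z => ∑ j ∈ s, f j x z) = ∑ j ∈ s, pairExp p q N (f j) := by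
  simp only [pairExp, bexp_sum]

lemma pairExp_const (c : ℝ) : pairExp p q N (fun _ _ => c) = c := by
  simp only [pairExp, bexp_const]

lemma pairExp_abs_sub_le (hp : 0 ≤ p ∧ p ≤ 1) (hq : 0 ≤ q ∧ q ≤ 1)
    {f g h : (Fin N → Bool) → (Fin N → Bool) → ℝ} (H : ∀ x z, |f x z - g x z| ≤ h x z) :
    |pairExp p q N f - pairExp p q N g| ≤ pairExp p q N h := by
  rw [← pairExp_sub, abs_le, neg_eq_neg_one_mul, ← pairExp_const_mul]
  exact ⟨bexp_mono (fun _ => hp) fun x => bexp_mono (fun _ => hq) fun z => by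
      linarith [(abs_le.1 (H x z)).1],
    bexp_mono (fun _ => hp) fun x => bexp_mono (fun _ => hq) fun z => (abs_le.1 (H x z)).2⟩

lemma pairExp_abs_le (hp : 0 ≤ p ∧ p ≤ 1) (hq : 0 ≤ q ∧ q ≤ 1)
    {f : (Fin N → Bool) → (Fin N → Bool) → ℝ} {K : ℝ} (H : ∀ x z, |f x z| ≤ K) :
    |pairExp p q N f| ≤ K := by
  have h := pairExp_abs_sub_le hp hq (f := f) (g := fun _ _ => 0) (h := fun _ _ => K)
    (fun x z => by simpa using H x z)
  simpa [pairExp_const] using h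

lemma bexp_cntOne (p : ℝ) (x : Bool) (φ : ℕ → ℝ) :
    bexp (fun _ : Fin N => p) (fun xs => φ (cntOne x xs)) = binExp (bern p x) N φ := by
  have h := bexp_card_filter (N := N) p x (fun _ => True) φ
  simpa [cntOne] using h

lemma bexp_cntPair_fst (p : ℝ) (x z : Bool) (zs : Fin N → Bool) (φ : ℕ → ℝ) :
    bexp (fun _ : Fin N => p) (fun xs => φ (cntPair x z xs zs))
      = binExp (bern p x) (cntOne z zs) φ :=
  bexp_card_filter p x (fun i => zs i = z) φ

lemma bexp_cntPair_snd (p : ℝ) (x z : Bool) (xs : Fin N → Bool) (φ : ℕ → ℝ) :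
    bexp (fun _ : Fin N => p) (fun zs => φ (cntPair x z xs zs))
      = binExp (bern p z) (cntOne x xs) φ := by
  rw [cntOne, ← bexp_card_filter p z (fun i => xs i = x) φ]
  simp only [cntPair, and_comm]

/-- Given the X-part, a cell is empty with probability `(1 - p(z)) ^ N_x`; averaging over `N_x`
evaluates the binomial generating function. -/
lemma pairExp_emptyCells (p q : ℝ) (N : ℕ) :
    pairExp p q N emptyCells = ∑ x, ∑ z, (1 - bern p x * bern q z) ^ N := by
  have h : pairExp p q N emptyCells
      = pairExp p q N (fun xs zs => ∑ x, ∑ z, if cntPair x z xs zs = 0 then 1 else 0) := rfl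
  rw [h]
  simp only [pairExp_sum]
  refine Finset.sum_congr rfl fun x _ => Finset.sum_congr rfl fun z _ => ?_
  simp only [pairExp]
  simp only [bexp_cntPair_snd q x z _ (fun k => if k = 0 then 1 else 0), binExp_eq_zero]
  rw [bexp_cntOne p x (fun k => (1 - bern q z) ^ k), binExp_pow]
  congr 1
  ring

end PairExpectation

/-! ### Conditioning on X and Z: linearity in the outcomes and conditional bias. -/

section Conditioning

variable {N : ℕ} (θ : Params) (xs zs : Fin N → Bool)

/-- The coefficient of the `i`-th outcome in `R`. -/
def coefR (i : Fin N) : ℝ := sgn (xs i) / cntOne (xs i) xs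

/-- The coefficient of the `i`-th outcome in `M`. -/
def coefM (i : Fin N) : ℝ :=
  sgn (xs i) * (cntOne (zs i) zs / N) / cntPair (xs i) (zs i) xs zs

lemma cnt_true_eq (x z : Bool) (ys : Fin N → Bool) :
    cnt x z true (fun i => (xs i, zs i, ys i))
      = ∑ i, if xs i = x ∧ zs i = z then ind (ys i) else 0 := by
  simp only [cnt, Prod.mk.injEq, ind, ← ite_and, and_assoc]
  simp

lemma cntXZ_eq (x z : Bool) (ys : Fin N → Bool) :
    cntXZ x z (fun i => (xs i, zs i, ys i)) = cntPair x z xs zs := by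
  simp only [cntXZ, cnt, cntPair, Prod.mk.injEq]
  rw [← Nat.cast_add, ← Finset.card_union_of_disjoint]
  · congr 2
    ext i
    simp only [Finset.mem_union, Finset.mem_filter, Finset.mem_univ, true_and]
    cases ys i <;> simp
  · rw [Finset.disjoint_filter]
    rintro i - h h'
    simp_all

lemma R_eq_sum (ys : Fin N → Bool) :
    R (fun i => (xs i, zs i, ys i)) = ∑ i, coefR xs i * ind (ys i) := by
  simp only [coefR]
  rw [sum_pair_mul xs zs (fun i => ind (ys i)) (fun x _ => sgn x / cntOne x xs)]
  simp only [R, rawCond, cntXZ_eq, ← cntOne_fst, cnt_true_eq, Fintype.sum_bool, sgn]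
  simp only [if_true, Bool.false_eq_true, if_false]
  ring

lemma M_eq_sum (ys : Fin N → Bool) :
    M (fun i => (xs i, zs i, ys i)) = ∑ i, coefM xs zs i * ind (ys i) := by
  simp only [coefM]
  rw [sum_pair_mul xs zs (fun i => ind (ys i))
    (fun x z => sgn x * (cntOne z zs / N) / cntPair x z xs zs)]
  simp only [M, margTerm, cntXZ_eq, ← cntOne_snd, cnt_true_eq, Fintype.sum_bool, sgn]
  simp only [if_true, Bool.false_eq_true, if_false]
  ring

/-- The effect of `X` on `Y`. -/
def Params.effect : ℝ := ∑ x, ∑ z, sgn x * bern θ.pZ z * θ.pY x z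

/-- The dependence of the outcome probability on `Z` in the arm `X = x`. -/
def Params.slope (x : Bool) : ℝ := θ.pY x true - θ.pY x false

/-- The conditional variance of `Y` given `X = x` and `Z = z`. -/
def Params.condVar (x z : Bool) : ℝ := θ.pY x z * (1 - θ.pY x z)

/-- The conditional bias of `R` given the `X`- and `Z`-parts of the sample. -/
def Params.biasR : ℝ := ∑ i, coefR xs i * θ.pY (xs i) (zs i) - θ.effect

/-- The conditional bias of `M` given the `X`- and `Z`-parts of the sample. -/
def Params.biasM : ℝ := ∑ i, coefM xs zs i * θ.pY (xs i) (zs i) - θ.effect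

/-- The linearisation of `biasR` in the `Z`-part of the sample. -/
def Params.linR : ℝ :=
  ∑ i, sgn (xs i) * θ.slope (xs i) / cntOne (xs i) xs * ind (zs i)
    - ∑ i, sgn (xs i) * θ.slope (xs i) / cntOne (xs i) xs * θ.pZ

/-- The linearisation of `biasM` in the `Z`-part of the sample. -/
def Params.linM : ℝ :=
  ∑ i, (θ.slope true - θ.slope false) / N * ind (zs i)
    - ∑ _i : Fin N, (θ.slope true - θ.slope false) / N * θ.pZ

lemma Params.biasR_eq : θ.biasR xs zs
    = ∑ x, ∑ z, sgn x * θ.pY x z * (cntPair x z xs zs / cntOne x xs) - θ.effect := by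
  rw [Params.biasR]
  simp only [coefR]
  rw [sum_pair xs zs (fun x z => sgn x / cntOne x xs * θ.pY x z)]
  congr 1
  exact Finset.sum_congr rfl fun _ _ => Finset.sum_congr rfl fun _ _ => by ring

lemma Params.biasM_eq : θ.biasM xs zs
    = ∑ x, ∑ z, sgn x * θ.pY x z * (cntOne z zs / N)
      * ((cntPair x z xs zs : ℝ) / cntPair x z xs zs) - θ.effect := by
  rw [Params.biasM]
  simp only [coefM]
  rw [sum_pair xs zs (fun x z => sgn x * (cntOne z zs / N) / cntPair x z xs zs * θ.pY x z)]
  congr 1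
  exact Finset.sum_congr rfl fun _ _ => Finset.sum_congr rfl fun _ _ => by ring

lemma Params.linR_eq : θ.linR xs zs
    = ∑ x, ∑ z, sgn x * θ.slope x * (ind z - θ.pZ) * (cntPair x z xs zs / cntOne x xs) := by
  rw [Params.linR, ← Finset.sum_sub_distrib]
  rw [sum_pair xs zs (fun x z => sgn x * θ.slope x / cntOne x xs * ind z
    - sgn x * θ.slope x / cntOne x xs * θ.pZ)]
  exact Finset.sum_congr rfl fun _ _ => Finset.sum_congr rfl fun _ _ => by ring

lemma Params.linM_eq : θ.linM zs
    = ∑ z, (θ.slope true - θ.slope false) * (ind z - θ.pZ) * (cntOne z zs / N) := by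
  rw [Params.linM, ← Finset.sum_sub_distrib]
  rw [sum_one zs (fun z => (θ.slope true - θ.slope false) / N * ind z
    - (θ.slope true - θ.slope false) / N * θ.pZ)]
  exact Finset.sum_congr rfl fun _ _ => by ring

variable {θ xs zs}

/-- The frequencies `N_xz / N_x` sum to one over `z` when arm `x` is nonempty, so the bias in that
arm is the slope times the deviation of the frequency of `Z = 1` from `pZ`. -/
lemma Params.biasR_eq_linR (h : ∀ x z, (0 : ℝ) < cntPair x z xs zs) :
    θ.biasR xs zs = θ.linR xs zs := by
  rw [Params.biasR_eq, Params.linR_eq, Params.effect]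
  have h00 := h false false
  have h01 := h false true
  have h10 := h true false
  have h11 := h true true
  simp only [Fintype.sum_bool, sgn, bern, ind, Params.slope, cntOne_fst _ xs zs, if_true,
    Bool.false_eq_true, if_false]
  field_simp
  ring

/-- With all cells occupied each cell mean is conditionally unbiased, so the only bias is that of
the weights `N_z / N`. These are common to both arms, hence the difference of the slopes. -/
lemma Params.biasM_eq_linM (h : ∀ x z, (0 : ℝ) < cntPair x z xs zs) :
    θ.biasM xs zs = θ.linM zs := by
  rw [Params.biasM_eq, Params.linM_eq, Params.effect]
  have h00 := h false false
  have h01 := h false true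
  have h10 := h true false
  have h11 := h true true
  simp only [div_self (h _ _).ne', cntOne_total zs]
  simp only [Fintype.sum_bool, sgn, bern, ind, Params.slope, cntOne_snd _ xs zs, if_true,
    Bool.false_eq_true, if_false]
  field_simp
  ring

lemma Params.Valid.abs_pY_le (h : θ.Valid) (x z : Bool) : |θ.pY x z| ≤ 1 := by
  rw [abs_of_nonneg (h.2.2 x z).1]; exact (h.2.2 x z).2

lemma Params.Valid.abs_slope_le (h : θ.Valid) (x : Bool) : |θ.slope x| ≤ 1 := by
  have h1 := h.2.2 x true
  have h0 := h.2.2 x false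
  rw [Params.slope, abs_le]
  constructor <;> linarith [h1.1, h1.2, h0.1, h0.2]

lemma Params.Valid.abs_effect_le (h : θ.Valid) : |θ.effect| ≤ 4 := by
  rw [← mul_one (4 : ℝ)]
  refine abs_sum_sum_bool_le fun x z => ?_
  rw [abs_mul, abs_mul, abs_sgn, abs_of_nonneg (bern_nonneg h.pZ_mem z), one_mul]
  exact mul_le_one₀ (bern_le_one h.pZ_mem z) (abs_nonneg _) (h.abs_pY_le x z)

lemma Params.Valid.abs_ind_sub_le (h : θ.Valid) (z : Bool) : |ind z - θ.pZ| ≤ 1 := by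
  have := h.pZ_mem
  rw [abs_le]
  cases z <;> simp [ind] <;> constructor <;> linarith

lemma Params.Valid.abs_biasR_le (h : θ.Valid) : |θ.biasR xs zs| ≤ 8 := by
  rw [Params.biasR_eq]
  refine (abs_sub _ _).trans ?_
  have : |∑ x, ∑ z, sgn x * θ.pY x z * ((cntPair x z xs zs : ℝ) / cntOne x xs)| ≤ 4 * 1 := by
    refine abs_sum_sum_bool_le fun x z => ?_
    obtain ⟨h0, h1⟩ := cntPair_div_cntOne_fst_mem x z xs zs
    rw [abs_mul, abs_mul, abs_sgn, one_mul, abs_of_nonneg h0]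
    exact mul_le_one₀ (h.abs_pY_le x z) h0 h1
  linarith [h.abs_effect_le]

lemma Params.Valid.abs_biasM_le (h : θ.Valid) : |θ.biasM xs zs| ≤ 8 := by
  rw [Params.biasM_eq]
  refine (abs_sub _ _).trans ?_
  have : |∑ x, ∑ z, sgn x * θ.pY x z * (cntOne z zs / N)
      * ((cntPair x z xs zs : ℝ) / cntPair x z xs zs)| ≤ 4 * 1 := by
    refine abs_sum_sum_bool_le fun x z => ?_
    obtain ⟨h0, h1⟩ := cntOne_div_mem z zs
    have h2 : (0 : ℝ) ≤ (cntPair x z xs zs : ℝ) / cntPair x z xs zs := by positivity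
    rw [abs_mul, abs_mul, abs_mul, abs_sgn, one_mul, abs_of_nonneg h0, abs_of_nonneg h2]
    exact mul_le_one₀ (mul_le_one₀ (h.abs_pY_le x z) h0 h1) h2 (div_self_le_one _)
  linarith [h.abs_effect_le]

lemma Params.Valid.abs_linR_le (h : θ.Valid) : |θ.linR xs zs| ≤ 8 := by
  rw [Params.linR_eq]
  refine (abs_sum_sum_bool_le (K := 1) fun x z => ?_).trans (by norm_num)
  obtain ⟨h0, h1⟩ := cntPair_div_cntOne_fst_mem x z xs zs
  rw [abs_mul, abs_mul, abs_mul, abs_sgn, one_mul, abs_of_nonneg h0]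
  exact mul_le_one₀ (mul_le_one₀ (h.abs_slope_le x) (abs_nonneg _) (h.abs_ind_sub_le z)) h0 h1

lemma Params.Valid.abs_linM_le (h : θ.Valid) : |θ.linM zs| ≤ 8 := by
  rw [Params.linM_eq]
  have hz : ∀ z, |(θ.slope true - θ.slope false) * (ind z - θ.pZ) * ((cntOne z zs : ℝ) / N)|
      ≤ 2 := fun z => by
    obtain ⟨h0, h1⟩ := cntOne_div_mem z zs
    have h2 : |θ.slope true - θ.slope false| ≤ 2 :=
      (abs_sub _ _).trans (by linarith [h.abs_slope_le true, h.abs_slope_le false])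
    rw [mul_assoc, abs_mul, abs_mul, abs_of_nonneg h0]
    have := mul_le_one₀ (h.abs_ind_sub_le z) h0 h1
    nlinarith [abs_nonneg (θ.slope true - θ.slope false),
      mul_nonneg (abs_nonneg (ind z - θ.pZ)) h0]
  rw [Fintype.sum_bool]
  exact (abs_add_le _ _).trans (by linarith [hz true, hz false])

lemma Params.Valid.abs_condVar_le (h : θ.Valid) (x z : Bool) : |θ.condVar x z| ≤ 1 := by
  have := h.2.2 x z
  rw [Params.condVar, abs_of_nonneg (mul_nonneg this.1 (by linarith))]
  nlinarith

end Conditioning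

/-! ### Second moments of biases and coefficients. -/

section Moments

variable {N : ℕ} {θ : Params}

/-- The probability weight bounding the event that some cell of the table is empty. -/
def Params.emptyWeight (θ : Params) (N : ℕ) : ℝ := pairExp θ.pX θ.pZ N emptyCells

/-- The mean of `1 / N_x`. -/
def Params.invMean (θ : Params) (N : ℕ) (x : Bool) : ℝ :=
  binExp (bern θ.pX x) N fun k => 1 / (k : ℝ)

/-- The mean of `(N_z / N) ^ 2 / N_{xz}`. -/
def Params.cellMean (θ : Params) (N : ℕ) (x z : Bool) : ℝ :=
  binExp (bern θ.pZ z) N fun n =>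
    ((n : ℝ) / N) ^ 2 * binExp (bern θ.pX x) n fun k => 1 / (k : ℝ)

lemma Params.sampleExp_affine (θ : Params) {f : Sample N → ℝ}
    {a : (Fin N → Bool) → (Fin N → Bool) → Fin N → ℝ}
    (hf : ∀ xs zs (ys : Fin N → Bool), f (fun i => (xs i, zs i, ys i))
      = ∑ i, a xs zs i * ind (ys i)) (c : ℝ) :
    θ.sampleExp N (fun ω => f ω - c)
      = pairExp θ.pX θ.pZ N (fun xs zs => ∑ i, a xs zs i * θ.pY (xs i) (zs i) - c) := by
  simp only [Params.sampleExp, hf, bexp_affine, pairExp]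

lemma Params.sampleExp_affine_mul_affine (θ : Params) {f g : Sample N → ℝ}
    {a b : (Fin N → Bool) → (Fin N → Bool) → Fin N → ℝ}
    (hf : ∀ xs zs (ys : Fin N → Bool), f (fun i => (xs i, zs i, ys i))
      = ∑ i, a xs zs i * ind (ys i))
    (hg : ∀ xs zs (ys : Fin N → Bool), g (fun i => (xs i, zs i, ys i))
      = ∑ i, b xs zs i * ind (ys i)) (c d : ℝ) :
    θ.sampleExp N (fun ω => (f ω - c) * (g ω - d))
      = pairExp θ.pX θ.pZ N (fun xs zs => (∑ i, a xs zs i * θ.pY (xs i) (zs i) - c)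
          * (∑ i, b xs zs i * θ.pY (xs i) (zs i) - d))
        + pairExp θ.pX θ.pZ N (fun xs zs =>
            ∑ i, a xs zs i * b xs zs i * θ.condVar (xs i) (zs i)) := by
  rw [← pairExp_add]
  simp only [Params.sampleExp, hf, hg, bexp_affine_mul_affine, pairExp, Params.condVar]

/-- The covariance of two statistics that are linear in the outcomes, up to the probability of
an empty cell. -/
lemma Params.Valid.abs_covariance_sub_le (h : θ.Valid) {f g : Sample N → ℝ}
    {a b : (Fin N → Bool) → (Fin N → Bool) → Fin N → ℝ} {c : ℝ}
    {A' B' : (Fin N → Bool) → (Fin N → Bool) → ℝ}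
    (hf : ∀ xs zs (ys : Fin N → Bool), f (fun i => (xs i, zs i, ys i))
      = ∑ i, a xs zs i * ind (ys i))
    (hg : ∀ xs zs (ys : Fin N → Bool), g (fun i => (xs i, zs i, ys i))
      = ∑ i, b xs zs i * ind (ys i))
    (hA : ∀ xs zs, |∑ i, a xs zs i * θ.pY (xs i) (zs i) - c| ≤ 8)
    (hB : ∀ xs zs, |∑ i, b xs zs i * θ.pY (xs i) (zs i) - c| ≤ 8)
    (hA' : ∀ xs zs, |A' xs zs| ≤ 8) (hB' : ∀ xs zs, |B' xs zs| ≤ 8)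
    (hAA' : ∀ xs zs, (∀ x z, (0 : ℝ) < cntPair x z xs zs) →
      ∑ i, a xs zs i * θ.pY (xs i) (zs i) - c = A' xs zs)
    (hBB' : ∀ xs zs, (∀ x z, (0 : ℝ) < cntPair x z xs zs) →
      ∑ i, b xs zs i * θ.pY (xs i) (zs i) - c = B' xs zs)
    (hA0 : pairExp θ.pX θ.pZ N A' = 0) :
    |covariance f g (θ.sampleLaw N)
      - (pairExp θ.pX θ.pZ N (fun xs zs => A' xs zs * B' xs zs)
        + pairExp θ.pX θ.pZ N (fun xs zs =>
            ∑ i, a xs zs i * b xs zs i * θ.condVar (xs i) (zs i)))|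
      ≤ 256 * θ.emptyWeight N := by
  rw [h.covariance_eq f g c c, θ.sampleExp_affine_mul_affine hf hg, θ.sampleExp_affine hf,
    θ.sampleExp_affine hg]
  set EA := pairExp θ.pX θ.pZ N (fun xs zs => ∑ i, a xs zs i * θ.pY (xs i) (zs i) - c) with hEA
  set EB := pairExp θ.pX θ.pZ N (fun xs zs => ∑ i, b xs zs i * θ.pY (xs i) (zs i) - c) with hEB
  -- The linearisation has mean zero, so the mean bias is nonzero only through empty cells. The
  -- product of the means and the replacement of the biases by `A'` and `B'` each cost at most 128
  -- times the weight.
  have h1 : |EA| ≤ 2 * 8 * θ.emptyWeight N := by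
    have := pairExp_abs_sub_le h.pX_mem h.pZ_mem
      (fun xs zs => abs_sub_le_emptyCells (hAA' xs zs) (hA xs zs) (hA' xs zs))
    rwa [← hEA, hA0, sub_zero, pairExp_const_mul] at this
  have h2 : |EB| ≤ 8 := pairExp_abs_le h.pX_mem h.pZ_mem hB
  have hmul : ∀ u v : ℝ, |u| ≤ 8 → |v| ≤ 8 → |u * v| ≤ 64 := fun u v hu hv => by
    rw [abs_mul]
    nlinarith [abs_nonneg u, abs_nonneg v]
  have h3 := pairExp_abs_sub_le h.pX_mem h.pZ_mem (fun xs zs => abs_sub_le_emptyCells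
    (fun hp => congrArg₂ (· * ·) (hAA' xs zs hp) (hBB' xs zs hp))
    (hmul _ _ (hA xs zs) (hB xs zs)) (hmul _ _ (hA' xs zs) (hB' xs zs)))
  rw [pairExp_const_mul] at h3
  change |_| ≤ 2 * 64 * θ.emptyWeight N at h3
  have h4 : |EA * EB| ≤ 128 * θ.emptyWeight N := by
    rw [abs_mul]
    nlinarith [abs_nonneg EA, abs_nonneg EB]
  rw [abs_le] at h3 h4 ⊢
  constructor <;> linarith [h3.1, h3.2, h4.1, h4.2]

lemma Params.pairExp_linR (θ : Params) (N : ℕ) :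
    pairExp θ.pX θ.pZ N (fun xs zs => θ.linR xs zs) = 0 := by
  simp only [pairExp, Params.linR, bexp_affine, sub_self, bexp_const]

lemma Params.pairExp_linM (θ : Params) (N : ℕ) :
    pairExp θ.pX θ.pZ N (fun _ zs => θ.linM zs) = 0 := by
  simp only [pairExp, Params.linM, bexp_affine, sub_self, bexp_const]

/-- Holds at `k = 0` too because of `1/0 = 0`, so empty arms and cells need no separate treatment
below. -/
lemma mul_div_self_sq (k : ℝ) : k * (1 / k ^ 2) = 1 / k := by
  rcases eq_or_ne k 0 with rfl | hk
  · simp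
  · field_simp

/-- Given the X-part, `linR` is a centred sum of independent terms; the `N_x` terms of arm `x` each
have variance `slope² pZ (1 - pZ) / N_x²`. -/
lemma Params.pairExp_linR_mul_linR (θ : Params) (N : ℕ) :
    pairExp θ.pX θ.pZ N (fun xs zs => θ.linR xs zs * θ.linR xs zs)
      = θ.pZ * (1 - θ.pZ) * ∑ x, θ.slope x ^ 2 * θ.invMean N x := by
  simp only [pairExp, Params.linR, bexp_affine_mul_affine, sub_self, zero_mul, zero_add]
  have hx : ∀ xs : Fin N → Bool,
      ∑ i, sgn (xs i) * θ.slope (xs i) / cntOne (xs i) xs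
        * (sgn (xs i) * θ.slope (xs i) / cntOne (xs i) xs) * (θ.pZ * (1 - θ.pZ))
      = ∑ x, θ.pZ * (1 - θ.pZ) * θ.slope x ^ 2 * (1 / (cntOne x xs : ℝ)) := fun xs => by
    rw [sum_one xs (fun x => sgn x * θ.slope x / cntOne x xs
        * (sgn x * θ.slope x / cntOne x xs) * (θ.pZ * (1 - θ.pZ)))]
    refine Finset.sum_congr rfl fun x _ => ?_
    rw [← mul_div_self_sq]
    linear_combination (cntOne x xs * (1 / (cntOne x xs : ℝ) ^ 2) * (θ.pZ * (1 - θ.pZ))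
      * θ.slope x ^ 2) * sgn_mul_self x
  simp only [hx, bexp_sum, bexp_const_mul, Finset.mul_sum]
  refine Finset.sum_congr rfl fun x _ => ?_
  rw [bexp_cntOne θ.pX x (fun k => 1 / (k : ℝ)), Params.invMean]
  ring

lemma Params.pairExp_linM_mul_linM (θ : Params) (N : ℕ) :
    pairExp θ.pX θ.pZ N (fun _ zs => θ.linM zs * θ.linM zs)
      = θ.pZ * (1 - θ.pZ) * ((θ.slope true - θ.slope false) ^ 2 / N) := by
  simp only [pairExp, Params.linM, bexp_affine_mul_affine, sub_self, zero_mul, zero_add,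
    bexp_const]
  rw [Finset.sum_const, Finset.card_univ, Fintype.card_fin, nsmul_eq_mul, div_eq_mul_one_div
    (_ ^ 2), ← mul_div_self_sq]
  ring

/-- Given the X-part, arm `x` contributes `N_x` products of coefficients of order `1/N_x` and `1/N`.
The ratio `N_x / N_x` is 1 unless the arm is empty, so the sum is that of `linM` with itself. -/
lemma Params.Valid.abs_pairExp_linR_mul_linM_sub_le (h : θ.Valid) (hN : 1 ≤ N) :
    |pairExp θ.pX θ.pZ N (fun xs zs => θ.linR xs zs * θ.linM zs)
      - θ.pZ * (1 - θ.pZ) * ((θ.slope true - θ.slope false) ^ 2 / N)| ≤ 8 * θ.emptyWeight N := by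
  have hN0 : (1 : ℝ) ≤ N := by exact_mod_cast hN
  have hs : |θ.slope true - θ.slope false| ≤ 2 :=
    (abs_sub _ _).trans (by linarith [h.abs_slope_le true, h.abs_slope_le false])
  have hσ : |θ.pZ * (1 - θ.pZ)| ≤ 1 := by
    have := h.pZ_mem
    rw [abs_of_nonneg (mul_nonneg this.1 (by linarith))]
    nlinarith
  have hT : pairExp θ.pX θ.pZ N (fun xs zs => θ.linR xs zs * θ.linM zs)
      = pairExp θ.pX θ.pZ N (fun xs _ => θ.pZ * (1 - θ.pZ) * ((θ.slope true - θ.slope false)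
        * (∑ x, sgn x * θ.slope x * ((cntOne x xs : ℝ) / cntOne x xs)) / N)) := by
    simp only [pairExp, Params.linM, Params.linR, bexp_affine_mul_affine, sub_self, zero_mul,
      zero_add, bexp_const]
    congr 1
    funext xs
    rw [sum_one xs (fun x => sgn x * θ.slope x / cntOne x xs
      * ((θ.slope true - θ.slope false) / N) * (θ.pZ * (1 - θ.pZ))), Finset.mul_sum,
      Finset.sum_div, Finset.mul_sum]
    exact Finset.sum_congr rfl fun _ _ => by ring
  have hbound : ∀ w : ℝ, |w| ≤ 2 →
      |θ.pZ * (1 - θ.pZ) * ((θ.slope true - θ.slope false) * w / N)| ≤ 4 := fun w hw => by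
    rw [abs_mul (θ.pZ * (1 - θ.pZ)), abs_div, abs_mul (θ.slope true - θ.slope false), Nat.abs_cast]
    have h1 : |θ.slope true - θ.slope false| * |w| / N ≤ 4 := by
      refine (div_le_self (by positivity) hN0).trans ?_
      nlinarith [abs_nonneg w, abs_nonneg (θ.slope true - θ.slope false)]
    calc _ ≤ 1 * (|θ.slope true - θ.slope false| * |w| / N) := by gcongr
      _ ≤ 4 := by linarith
  have key := pairExp_abs_sub_le (N := N) h.pX_mem h.pZ_mem (fun xs zs =>
    abs_sub_le_emptyCells (xs := xs) (zs := zs)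
      (a := θ.pZ * (1 - θ.pZ) * ((θ.slope true - θ.slope false)
        * (∑ x, sgn x * θ.slope x * ((cntOne x xs : ℝ) / cntOne x xs)) / N))
      (b := θ.pZ * (1 - θ.pZ) * ((θ.slope true - θ.slope false)
        * (θ.slope true - θ.slope false) / N)) (K := 4) (fun hp => by
          have h1 : ∀ x, (cntOne x xs : ℝ) / cntOne x xs = 1 := fun x => by
            refine div_self (ne_of_gt ?_)
            rw [cntOne_fst x xs zs]
            exact add_pos (hp x false) (hp x true)
          simp only [h1, Fintype.sum_bool, sgn, if_true, Bool.false_eq_true, if_false]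
          ring)
      (hbound _ (by
        have hx : ∀ x, |sgn x * θ.slope x * ((cntOne x xs : ℝ) / cntOne x xs)| ≤ 1 := fun x => by
          have h2 : (0 : ℝ) ≤ (cntOne x xs : ℝ) / cntOne x xs := by positivity
          rw [abs_mul, abs_mul, abs_sgn, one_mul, abs_of_nonneg h2]
          exact mul_le_one₀ (h.abs_slope_le x) h2 (div_self_le_one _)
        rw [Fintype.sum_bool]
        exact (abs_add_le _ _).trans (by linarith [hx true, hx false])))
      (hbound _ hs))
  rw [← hT, pairExp_const, pairExp_const_mul] at key
  rw [sq]
  refine key.trans (le_of_eq ?_)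
  rw [Params.emptyWeight]
  ring

/-- Given the X-part, `N_xz` has mean `N_x p(z)`, which turns `N_xz / N_x²` into `p(z) / N_x`. -/
lemma Params.pairExp_coefR_mul_coefR (θ : Params) (N : ℕ) :
    pairExp θ.pX θ.pZ N (fun xs zs => ∑ i, coefR xs i * coefR xs i * θ.condVar (xs i) (zs i))
      = ∑ x, ∑ z, θ.condVar x z * (bern θ.pZ z * θ.invMean N x) := by
  have hx : ∀ xs zs : Fin N → Bool, ∑ i, coefR xs i * coefR xs i * θ.condVar (xs i) (zs i)
      = ∑ x, ∑ z, θ.condVar x z * (cntPair x z xs zs / (cntOne x xs : ℝ) ^ 2) := fun xs zs => by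
    simp only [coefR]
    rw [sum_pair xs zs (fun x z => sgn x / cntOne x xs * (sgn x / cntOne x xs) * θ.condVar x z)]
    refine Finset.sum_congr rfl fun x _ => Finset.sum_congr rfl fun z _ => ?_
    linear_combination (cntPair x z xs zs * (1 / (cntOne x xs : ℝ) ^ 2) * θ.condVar x z)
      * sgn_mul_self x
  simp only [hx, pairExp_sum, pairExp_const_mul]
  refine Finset.sum_congr rfl fun x _ => Finset.sum_congr rfl fun z _ => ?_
  congr 1
  simp only [pairExp, div_eq_mul_inv, mul_comm _ ((_ : ℝ)⁻¹), bexp_const_mul]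
  simp only [bexp_cntPair_snd θ.pZ x z _ (fun k => (k : ℝ)), binExp_id]
  rw [Params.invMean, ← bexp_cntOne θ.pX x, ← bexp_const_mul]
  congr 1
  funext xs
  rw [← mul_div_self_sq]
  ring

/-- Here the conditioning is on the Z-part: given it, the weight `N_z / N` is fixed and `N_xz` is
binomial with `N_z` trials. -/
lemma Params.pairExp_coefM_mul_coefM (θ : Params) (N : ℕ) :
    pairExp θ.pX θ.pZ N
        (fun xs zs => ∑ i, coefM xs zs i * coefM xs zs i * θ.condVar (xs i) (zs i))
      = ∑ x, ∑ z, θ.condVar x z * θ.cellMean N x z := by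
  have hx : ∀ xs zs : Fin N → Bool,
      ∑ i, coefM xs zs i * coefM xs zs i * θ.condVar (xs i) (zs i)
      = ∑ x, ∑ z, θ.condVar x z * (((cntOne z zs : ℝ) / N) ^ 2 * (1 / (cntPair x z xs zs : ℝ))) :=
    fun xs zs => by
    simp only [coefM]
    rw [sum_pair xs zs (fun x z => sgn x * (cntOne z zs / N) / cntPair x z xs zs
      * (sgn x * (cntOne z zs / N) / cntPair x z xs zs) * θ.condVar x z)]
    refine Finset.sum_congr rfl fun x _ => Finset.sum_congr rfl fun z _ => ?_
    rw [← mul_div_self_sq]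
    linear_combination (cntPair x z xs zs * (1 / (cntPair x z xs zs : ℝ) ^ 2)
      * ((cntOne z zs : ℝ) / N) ^ 2 * θ.condVar x z) * sgn_mul_self x
  simp only [hx, pairExp_sum, pairExp_const_mul]
  refine Finset.sum_congr rfl fun x _ => Finset.sum_congr rfl fun z _ => ?_
  congr 1
  simp only [pairExp]
  rw [bexp_comm]
  simp only [bexp_const_mul, bexp_cntPair_fst θ.pX x z _ (fun k => 1 / (k : ℝ))]
  exact bexp_cntOne θ.pZ z (fun n =>
    ((n : ℝ) / N) ^ 2 * binExp (bern θ.pX x) n fun k => 1 / (k : ℝ))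

/-- In an occupied cell `N_xz` cancels, leaving `(1/N_x) (N_z/N)`, whose mean factors because X and
Z are independent. The result is the outcome part of `V[R]`. -/
lemma Params.Valid.abs_pairExp_coefR_mul_coefM_sub_le (h : θ.Valid) (hN : 1 ≤ N) :
    |pairExp θ.pX θ.pZ N
        (fun xs zs => ∑ i, coefR xs i * coefM xs zs i * θ.condVar (xs i) (zs i))
      - ∑ x, ∑ z, θ.condVar x z * (bern θ.pZ z * θ.invMean N x)| ≤ 8 * θ.emptyWeight N := by
  have hN0 : (0 : ℝ) < N := by exact_mod_cast hN
  have hx : ∀ xs zs : Fin N → Bool,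
      ∑ i, coefR xs i * coefM xs zs i * θ.condVar (xs i) (zs i)
      = ∑ x, ∑ z, θ.condVar x z * ((1 / (cntOne x xs : ℝ)) * ((cntOne z zs : ℝ) / N)
        * ((cntPair x z xs zs : ℝ) / cntPair x z xs zs)) :=
    fun xs zs => by
    simp only [coefM, coefR]
    rw [sum_pair xs zs (fun x z => sgn x / cntOne x xs
      * (sgn x * (cntOne z zs / N) / cntPair x z xs zs) * θ.condVar x z)]
    refine Finset.sum_congr rfl fun x _ => Finset.sum_congr rfl fun z _ => ?_
    linear_combination (cntPair x z xs zs / (cntPair x z xs zs : ℝ)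
      * ((cntOne z zs : ℝ) / N) * (1 / (cntOne x xs : ℝ)) * θ.condVar x z) * sgn_mul_self x
  have hT : ∑ x, ∑ z, θ.condVar x z * (bern θ.pZ z * θ.invMean N x)
      = pairExp θ.pX θ.pZ N (fun xs zs => ∑ x, ∑ z, θ.condVar x z
        * ((1 / (cntOne x xs : ℝ)) * ((cntOne z zs : ℝ) / N) * 1)) := by
    simp only [pairExp_sum, pairExp_const_mul]
    refine Finset.sum_congr rfl fun x _ => Finset.sum_congr rfl fun z _ => ?_
    congr 1
    simp only [pairExp, mul_one, bexp_const_mul]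
    have h1 : bexp (fun _ : Fin N => θ.pZ) (fun zs => (cntOne z zs : ℝ) / N) = bern θ.pZ z := by
      simp only [div_eq_inv_mul, bexp_const_mul]
      rw [bexp_cntOne θ.pZ z (fun k => (k : ℝ)), binExp_id]
      field_simp
    rw [h1]
    simp only [mul_comm _ (bern θ.pZ z), bexp_const_mul]
    rw [Params.invMean, ← bexp_cntOne θ.pX x]
  have hbound : ∀ (xs zs : Fin N → Bool) (x z : Bool) (w : ℝ), 0 ≤ w ∧ w ≤ 1 →
      |θ.condVar x z * ((1 / (cntOne x xs : ℝ)) * ((cntOne z zs : ℝ) / N) * w)| ≤ 1 :=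
    fun xs zs x z w hw => by
    obtain ⟨h0, h1⟩ := cntOne_div_mem z zs
    have h2 : 0 ≤ 1 / (cntOne x xs : ℝ) := by positivity
    have h3 : 1 / (cntOne x xs : ℝ) ≤ 1 := by
      rcases Nat.eq_zero_or_pos (cntOne x xs) with hc | hc
      · simp [hc]
      · rw [div_le_one (by exact_mod_cast hc)]
        exact_mod_cast hc
    rw [abs_mul, abs_of_nonneg (mul_nonneg (mul_nonneg h2 h0) hw.1)]
    exact mul_le_one₀ (h.abs_condVar_le x z) (mul_nonneg (mul_nonneg h2 h0) hw.1)
      (mul_le_one₀ (mul_le_one₀ h3 h0 h1) hw.1 hw.2)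
  rw [hT]
  simp only [hx]
  have key := pairExp_abs_sub_le (N := N) h.pX_mem h.pZ_mem (fun xs zs =>
    abs_sub_le_emptyCells (xs := xs) (zs := zs)
      (a := ∑ x, ∑ z, θ.condVar x z * ((1 / (cntOne x xs : ℝ)) * ((cntOne z zs : ℝ) / N)
        * ((cntPair x z xs zs : ℝ) / cntPair x z xs zs)))
      (b := ∑ x, ∑ z, θ.condVar x z * ((1 / (cntOne x xs : ℝ)) * ((cntOne z zs : ℝ) / N) * 1))
      (K := 4 * 1)
      (fun hp => by simp only [div_self (hp _ _).ne'])
      (abs_sum_sum_bool_le fun x z => hbound xs zs x z _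
        ⟨by positivity, div_self_le_one _⟩)
      (abs_sum_sum_bool_le fun x z => hbound xs zs x z _ ⟨by norm_num, le_refl _⟩))
  rw [pairExp_const_mul] at key
  refine key.trans (le_of_eq ?_)
  rw [Params.emptyWeight]
  ring

end Moments

/-! ### The two variances and the covariance up to empty cells. -/

section Covariances

variable {N : ℕ} {θ : Params}

lemma Params.Valid.abs_varR_sub_le (h : θ.Valid) :
    |θ.varR N - (θ.pZ * (1 - θ.pZ) * ∑ x, θ.slope x ^ 2 * θ.invMean N x
      + ∑ x, ∑ z, θ.condVar x z * (bern θ.pZ z * θ.invMean N x))| ≤ 256 * θ.emptyWeight N := by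
  rw [h.varR_eq, ← θ.pairExp_linR_mul_linR, ← θ.pairExp_coefR_mul_coefR]
  exact h.abs_covariance_sub_le (fun xs zs ys => R_eq_sum xs zs ys)
    (fun xs zs ys => R_eq_sum xs zs ys) (fun _ _ => h.abs_biasR_le) (fun _ _ => h.abs_biasR_le)
    (fun _ _ => h.abs_linR_le) (fun _ _ => h.abs_linR_le)
    (fun _ _ hp => Params.biasR_eq_linR hp) (fun _ _ hp => Params.biasR_eq_linR hp)
    (θ.pairExp_linR N)

lemma Params.Valid.abs_varM_sub_le (h : θ.Valid) :
    |θ.varM N - (θ.pZ * (1 - θ.pZ) * ((θ.slope true - θ.slope false) ^ 2 / N)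
      + ∑ x, ∑ z, θ.condVar x z * θ.cellMean N x z)| ≤ 256 * θ.emptyWeight N := by
  rw [h.varM_eq, ← θ.pairExp_linM_mul_linM, ← θ.pairExp_coefM_mul_coefM]
  exact h.abs_covariance_sub_le M_eq_sum M_eq_sum (fun _ _ => h.abs_biasM_le)
    (fun _ _ => h.abs_biasM_le) (fun _ _ => h.abs_linM_le) (fun _ _ => h.abs_linM_le)
    (fun _ _ hp => Params.biasM_eq_linM hp) (fun _ _ hp => Params.biasM_eq_linM hp)
    (θ.pairExp_linM N)

lemma Params.Valid.abs_covRM_sub_le (h : θ.Valid) (hN : 1 ≤ N) :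
    |θ.covRM N - (θ.pZ * (1 - θ.pZ) * ((θ.slope true - θ.slope false) ^ 2 / N)
      + ∑ x, ∑ z, θ.condVar x z * (bern θ.pZ z * θ.invMean N x))| ≤ 272 * θ.emptyWeight N := by
  have h1 := h.abs_pairExp_linR_mul_linM_sub_le hN
  have h2 := h.abs_pairExp_coefR_mul_coefM_sub_le hN
  have h3 := h.abs_covariance_sub_le (fun xs zs ys => R_eq_sum xs zs ys) M_eq_sum
    (fun _ _ => h.abs_biasR_le)
    (fun _ _ => h.abs_biasM_le) (fun _ _ => h.abs_linR_le) (fun _ _ => h.abs_linM_le)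
    (fun _ _ hp => Params.biasR_eq_linR hp) (fun _ _ hp => Params.biasM_eq_linM hp)
    (θ.pairExp_linR N)
  rw [Params.covRM]
  rw [abs_le] at *
  constructor <;> linarith [h1.1, h1.2, h2.1, h2.2, h3.1, h3.2]

end Covariances

/-! ### Expansions in 1/N, uniform in the outcome probabilities. -/

section Expansion

lemma exists_invMean_expansion {p : ℝ} (hp : 0 < p ∧ p < 1) :
    ∃ K : ℝ, 0 ≤ K ∧ ∀ (θ : Params) (N : ℕ), 1 ≤ N → θ.pX = p → ∀ x,
      |θ.invMean N x - (1 / (N * bern p x) + (1 - bern p x) / (bern p x ^ 2 * N ^ 2))|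
        ≤ K / N ^ 3 := by
  choose K hK0 hK using fun x => exists_binExp_inv_expansion (p := bern p x)
    ⟨bern_pos hp x, bern_lt_one hp x⟩
  refine ⟨K true + K false, add_nonneg (hK0 _) (hK0 _), fun θ N hN hθ x => ?_⟩
  subst hθ
  have hN0 : (0 : ℝ) < N := by exact_mod_cast hN
  have hpx := bern_pos hp x
  have h := hK x N
  have hle : K x ≤ K true + K false := by cases x <;> linarith [hK0 true, hK0 false]
  rw [Params.invMean]
  set g := binExp (bern θ.pX x) N fun k => 1 / (k : ℝ)
  have e : g - (1 / (N * bern θ.pX x) + (1 - bern θ.pX x) / (bern θ.pX x ^ 2 * N ^ 2))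
      = ((N : ℝ) ^ 2 * g - (N / bern θ.pX x + (1 - bern θ.pX x) / bern θ.pX x ^ 2)) / N ^ 2 := by
    field_simp
  rw [e, abs_div, abs_of_pos (by positivity : (0 : ℝ) < (N : ℝ) ^ 2)]
  calc _ ≤ K x * (1 / ((N : ℝ) + 1)) / N ^ 2 := by gcongr
    _ ≤ (K true + K false) * (1 / (N : ℝ)) / N ^ 2 := by
        have := hK0 x
        gcongr <;> linarith
    _ = _ := by field_simp

/-- The reciprocal expansion is applied given `N_z = n`. The factor `n²` makes its main part affine
in `n`, so it averages exactly, and the error `1/(n+1)` averages to order `1/N`. -/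
lemma exists_cellMean_expansion {p q : ℝ} (hp : 0 < p ∧ p < 1) (hq : 0 < q ∧ q < 1) :
    ∃ K : ℝ, 0 ≤ K ∧ ∀ (θ : Params) (N : ℕ), 1 ≤ N → θ.pX = p → θ.pZ = q → ∀ x z,
      |θ.cellMean N x z
        - (bern q z / (N * bern p x) + (1 - bern p x) / (bern p x ^ 2 * N ^ 2))|
        ≤ K / N ^ 3 := by
  choose K hK0 hK using fun x => exists_binExp_inv_expansion (p := bern p x)
    ⟨bern_pos hp x, bern_lt_one hp x⟩
  have hq1 := bern_pos hq true
  have hq0 := bern_pos hq false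
  refine ⟨(K true + K false) * (1 / bern q true + 1 / bern q false),
    mul_nonneg (add_nonneg (hK0 _) (hK0 _)) (by positivity), fun θ N hN hX hZ x z => ?_⟩
  subst hX hZ
  have hN0 : (0 : ℝ) < N := by exact_mod_cast hN
  have hpx := bern_pos hp x
  have hqz := bern_pos hq z
  have hqz' : 0 ≤ bern θ.pZ z ∧ bern θ.pZ z ≤ 1 := ⟨hqz.le, (bern_lt_one hq z).le⟩
  have hle : K x * (1 / bern θ.pZ z)
      ≤ (K true + K false) * (1 / bern θ.pZ true + 1 / bern θ.pZ false) := by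
    have h1 : K x ≤ K true + K false := by cases x <;> linarith [hK0 true, hK0 false]
    have i1 : 0 < 1 / bern θ.pZ true := by positivity
    have i0 : 0 < 1 / bern θ.pZ false := by positivity
    have h2 : 1 / bern θ.pZ z ≤ 1 / bern θ.pZ true + 1 / bern θ.pZ false := by
      cases z <;> linarith
    exact mul_le_mul h1 h2 (by positivity) (add_nonneg (hK0 _) (hK0 _))
  have h := binExp_abs_sub_le hqz' (n := N) (hK x)
  rw [binExp_const_mul] at h
  have hlin : binExp (bern θ.pZ z) N
      (fun n => (n : ℝ) / bern θ.pX x + (1 - bern θ.pX x) / bern θ.pX x ^ 2)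
      = N * bern θ.pZ z / bern θ.pX x + (1 - bern θ.pX x) / bern θ.pX x ^ 2 := by
    rw [binExp_add, binExp_const, binExp_congr fun k => div_eq_inv_mul (k : ℝ) _,
      binExp_const_mul, binExp_id]
    ring
  rw [hlin] at h
  have hcell : θ.cellMean N x z = 1 / N ^ 2 * binExp (bern θ.pZ z) N
      (fun n => (n : ℝ) ^ 2 * binExp (bern θ.pX x) n fun k => 1 / (k : ℝ)) := by
    rw [Params.cellMean, ← binExp_const_mul]
    exact binExp_congr fun k => by ring
  rw [hcell]
  set g := binExp (bern θ.pZ z) N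
      (fun n => (n : ℝ) ^ 2 * binExp (bern θ.pX x) n fun k => 1 / (k : ℝ))
  have e : 1 / (N : ℝ) ^ 2 * g
      - (bern θ.pZ z / (N * bern θ.pX x) + (1 - bern θ.pX x) / (bern θ.pX x ^ 2 * N ^ 2))
      = (g - (N * bern θ.pZ z / bern θ.pX x + (1 - bern θ.pX x) / bern θ.pX x ^ 2)) / N ^ 2 := by
    field_simp
  rw [e, abs_div, abs_of_pos (by positivity : (0 : ℝ) < (N : ℝ) ^ 2)]
  have hx0 := hK0 x
  calc _ ≤ K x * (1 / (((N : ℝ) + 1) * bern θ.pZ z)) / N ^ 2 := by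
        gcongr
        refine h.trans ?_
        gcongr
        exact binExp_inv_add_one_le ⟨hqz, bern_lt_one hq z⟩ N
    _ ≤ K x * (1 / ((N : ℝ) * bern θ.pZ z)) / N ^ 2 := by
        gcongr
        linarith
    _ = K x * (1 / bern θ.pZ z) / N ^ 3 := by field_simp
    _ ≤ _ := by gcongr

lemma exists_pow_le_inv_cube {r : ℝ} (hr : 0 ≤ r ∧ r < 1) :
    ∃ K : ℝ, 0 ≤ K ∧ ∀ N : ℕ, 1 ≤ N → r ^ N ≤ K / N ^ 3 := by
  obtain ⟨Q, hQ⟩ := (tendsto_pow_const_mul_const_pow_of_abs_lt_one 3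
    (show |r| < 1 by rw [abs_of_nonneg hr.1]; exact hr.2)).bddAbove_range
  have hQ' : ∀ n : ℕ, (n : ℝ) ^ 3 * r ^ n ≤ Q := fun n => hQ ⟨n, rfl⟩
  refine ⟨Q, by simpa using hQ' 0, fun N hN => ?_⟩
  have hN0 : (0 : ℝ) < N := by exact_mod_cast hN
  rw [le_div_iff₀ (by positivity), mul_comm]
  exact hQ' N

lemma exists_emptyWeight_le {p q : ℝ} (hp : 0 < p ∧ p < 1) (hq : 0 < q ∧ q < 1) :
    ∃ K : ℝ, 0 ≤ K ∧ ∀ (θ : Params) (N : ℕ), 1 ≤ N → θ.pX = p → θ.pZ = q →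
      θ.emptyWeight N ≤ K / N ^ 3 := by
  have hr : ∀ x z, 0 ≤ 1 - bern p x * bern q z ∧ 1 - bern p x * bern q z < 1 := fun x z =>
    ⟨by nlinarith [bern_pos hp x, bern_pos hq z, bern_lt_one hp x, bern_lt_one hq z],
      by linarith [mul_pos (bern_pos hp x) (bern_pos hq z)]⟩
  choose K hK0 hK using fun x z => exists_pow_le_inv_cube (hr x z)
  refine ⟨∑ x, ∑ z, K x z, Finset.sum_nonneg fun x _ => Finset.sum_nonneg fun z _ => hK0 x z,
    fun θ N hN hX hZ => ?_⟩
  rw [Params.emptyWeight, pairExp_emptyCells, hX, hZ, Finset.sum_div]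
  refine Finset.sum_le_sum fun x _ => ?_
  rw [Finset.sum_div]
  exact Finset.sum_le_sum fun z _ => hK x z N hN

/-- The expansion of `(C[R, M] - V[R]) N`, uniformly in the outcome probabilities. -/
lemma exists_covRM_sub_varR_expansion {p q : ℝ} (hp : 0 < p ∧ p < 1) (hq : 0 < q ∧ q < 1) :
    ∃ K : ℝ, 0 ≤ K ∧ ∀ (θ : Params) (N : ℕ), 1 ≤ N → θ.Valid → θ.pX = p → θ.pZ = q →
      |(θ.covRM N - θ.varR N) * N
        - q * (1 - q) * ((θ.slope true - θ.slope false) ^ 2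
          - (θ.slope true ^ 2 / p + θ.slope false ^ 2 / (1 - p)))|
        ≤ K * ((θ.slope true ^ 2 + θ.slope false ^ 2) / N + 1 / N ^ 2) := by
  obtain ⟨K₁, hK₁, h₁⟩ := exists_invMean_expansion hp
  obtain ⟨K₂, hK₂, h₂⟩ := exists_emptyWeight_le hp hq
  set A : ℝ := (1 - p) / p ^ 2 + p / (1 - p) ^ 2 with hA
  have hp0 := hp.1
  have hp1 : 0 < 1 - p := by linarith [hp.2]
  have hA0 : 0 ≤ A := by positivity
  refine ⟨A + K₁ + 528 * K₂, by positivity, fun θ N hN hθ hX hZ => ?_⟩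
  have hN0 : (1 : ℝ) ≤ N := by exact_mod_cast hN
  have hN0' : (0 : ℝ) < N := by linarith
  have hσ : 0 ≤ q * (1 - q) ∧ q * (1 - q) ≤ 1 :=
    ⟨mul_nonneg hq.1.le (by linarith [hq.2]), by nlinarith [hq.1, hq.2]⟩
  have hcov := hθ.abs_covRM_sub_le hN
  have hvar := hθ.abs_varR_sub_le (N := N)
  have hempty := h₂ θ N hN hX hZ
  rw [hZ] at hcov hvar
  have hg : ∀ x, |θ.invMean N x * N - 1 / bern p x| ≤ (A + K₁) / N := fun x => by
    have hx := h₁ θ N hN hX x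
    have hb := bern_pos hp x
    have hb1 := bern_lt_one hp x
    have hAx : (1 - bern p x) / bern p x ^ 2 ≤ A := by
      have i1 : 0 ≤ (1 - p) / p ^ 2 := by positivity
      have i2 : 0 ≤ p / (1 - p) ^ 2 := by positivity
      cases x
      · simp only [bern, Bool.false_eq_true, if_false, sub_sub_cancel]; linarith
      · simp only [bern, if_true]; linarith
    have e : θ.invMean N x * N - 1 / bern p x
        = (θ.invMean N x - (1 / (N * bern p x) + (1 - bern p x) / (bern p x ^ 2 * N ^ 2))) * N
          + (1 - bern p x) / bern p x ^ 2 / N := by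
      field_simp
      ring
    rw [e]
    refine (abs_add_le _ _).trans ?_
    have i3 : 0 ≤ (1 - bern p x) / bern p x ^ 2 / (N : ℝ) :=
      div_nonneg (div_nonneg (by linarith) (by positivity)) (by positivity)
    rw [abs_mul, abs_of_pos hN0', abs_of_nonneg i3]
    calc _ ≤ K₁ / N ^ 3 * N + A / N := by gcongr
      _ = K₁ / N / N + A / N := by field_simp
      _ ≤ K₁ / N + A / N := by
          gcongr
          exact div_le_self (by positivity) hN0
      _ = _ := by ring
  have hT := hg true
  have hF := hg false
  simp only [Fintype.sum_bool (f := fun x => θ.slope x ^ 2 * θ.invMean N x)] at hvar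
  have b1 : bern p true = p := rfl
  have b0 : bern p false = 1 - p := rfl
  rw [b1] at hT
  rw [b0] at hF
  set S := ∑ x, ∑ z, θ.condVar x z * (bern q z * θ.invMean N x)
  set s₁ := θ.slope true
  set s₀ := θ.slope false
  set g₁ := θ.invMean N true
  set g₀ := θ.invMean N false
  set δ := θ.emptyWeight N
  set u := θ.covRM N
  set v := θ.varR N
  -- The common outcome part `S` cancels, whatever its size. The constant 528 below is 272 + 256.
  have e : (u - v) * N - q * (1 - q) * ((s₁ - s₀) ^ 2 - (s₁ ^ 2 / p + s₀ ^ 2 / (1 - p)))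
      = ((u - (q * (1 - q) * ((s₁ - s₀) ^ 2 / N) + S))
          - (v - (q * (1 - q) * (s₁ ^ 2 * g₁ + s₀ ^ 2 * g₀) + S))) * N
        - q * (1 - q) * (s₁ ^ 2 * (g₁ * N - 1 / p) + s₀ ^ 2 * (g₀ * N - 1 / (1 - p))) := by
    field_simp
    ring
  rw [e]
  refine (abs_sub _ _).trans ?_
  have i1 : |((u - (q * (1 - q) * ((s₁ - s₀) ^ 2 / N) + S))
          - (v - (q * (1 - q) * (s₁ ^ 2 * g₁ + s₀ ^ 2 * g₀) + S))) * N| ≤ 528 * K₂ / N ^ 2 := by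
    rw [abs_mul, abs_of_pos hN0']
    calc _ ≤ (528 * (K₂ / N ^ 3)) * N := by
          gcongr
          exact (abs_sub _ _).trans (by linarith)
      _ = _ := by field_simp
  -- The squared slopes are kept in this bound: they are `O(1/N)` in the scaling limit.
  have i2 : |q * (1 - q) * (s₁ ^ 2 * (g₁ * N - 1 / p) + s₀ ^ 2 * (g₀ * N - 1 / (1 - p)))|
      ≤ (A + K₁) * ((s₁ ^ 2 + s₀ ^ 2) / N) := by
    rw [abs_mul, abs_of_nonneg hσ.1]
    calc _ ≤ 1 * (s₁ ^ 2 * ((A + K₁) / N) + s₀ ^ 2 * ((A + K₁) / N)) := by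
          refine mul_le_mul hσ.2 ((abs_add_le _ _).trans ?_) (abs_nonneg _) zero_le_one
          rw [abs_mul, abs_mul, abs_of_nonneg (sq_nonneg s₁), abs_of_nonneg (sq_nonneg s₀)]
          gcongr
      _ = _ := by ring
  have j1 : 0 ≤ (s₁ ^ 2 + s₀ ^ 2) / N := by positivity
  have j2 : 0 ≤ 1 / (N : ℝ) ^ 2 := by positivity
  have j3 : 528 * K₂ / (N : ℝ) ^ 2 = 528 * K₂ * (1 / (N : ℝ) ^ 2) := by ring
  rw [j3] at i1
  nlinarith [mul_nonneg hK₂ j1, mul_nonneg (add_nonneg hA0 hK₁) j2]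

/-- The expansion of `(C[R, M] - V[M]) N`, uniformly in the outcome probabilities. -/
lemma exists_covRM_sub_varM_expansion {p q : ℝ} (hp : 0 < p ∧ p < 1) (hq : 0 < q ∧ q < 1) :
    ∃ K : ℝ, 0 ≤ K ∧ ∀ (θ : Params) (N : ℕ), 1 ≤ N → θ.Valid → θ.pX = p → θ.pZ = q →
      |(θ.covRM N - θ.varM N) * N
        - ∑ x, ∑ z, θ.condVar x z
          * ((1 - bern p x) / bern p x ^ 2 * (bern q z - 1) * (1 / N))| ≤ K * (1 / N ^ 2) := by
  obtain ⟨K₁, hK₁, h₁⟩ := exists_invMean_expansion hp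
  obtain ⟨K₂, hK₂, h₂⟩ := exists_emptyWeight_le hp hq
  obtain ⟨K₃, hK₃, h₃⟩ := exists_cellMean_expansion hp hq
  refine ⟨4 * (K₁ + K₃) + 528 * K₂, by positivity, fun θ N hN hθ hX hZ => ?_⟩
  have hN0 : (0 : ℝ) < N := by exact_mod_cast hN
  have hcov := hθ.abs_covRM_sub_le hN
  have hvar := hθ.abs_varM_sub_le (N := N)
  have hempty := h₂ θ N hN hX hZ
  rw [hZ] at hcov hvar
  have hterm : ∀ x z, |θ.condVar x z * (bern q z * θ.invMean N x * N - θ.cellMean N x z * N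
      - (1 - bern p x) / bern p x ^ 2 * (bern q z - 1) * (1 / N))| ≤ (K₁ + K₃) / N ^ 2 :=
    fun x z => by
    have hx := h₁ θ N hN hX x
    have hxz := h₃ θ N hN hX hZ x z
    have hb := bern_pos hp x
    have hbz := bern_pos hq z
    have hbz1 := bern_lt_one hq z
    -- The first-order terms `p(z) / (N p(x))` of both means agree and cancel; the second-order
    -- terms differ by the factor `p(z) - 1`.
    have e : bern q z * θ.invMean N x * N - θ.cellMean N x z * N
        - (1 - bern p x) / bern p x ^ 2 * (bern q z - 1) * (1 / N)
        = (bern q z * (θ.invMean N x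
            - (1 / (N * bern p x) + (1 - bern p x) / (bern p x ^ 2 * N ^ 2)))
          - (θ.cellMean N x z
            - (bern q z / (N * bern p x) + (1 - bern p x) / (bern p x ^ 2 * N ^ 2)))) * N := by
      field_simp
      ring
    rw [e, abs_mul, abs_mul, abs_of_pos hN0]
    calc _ ≤ 1 * ((1 * (K₁ / N ^ 3) + K₃ / N ^ 3) * N) := by
          refine mul_le_mul (hθ.abs_condVar_le x z) ?_ (by positivity) zero_le_one
          gcongr
          refine (abs_sub _ _).trans (add_le_add ?_ hxz)
          rw [abs_mul, abs_of_pos hbz]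
          gcongr
      _ = _ := by field_simp
  have hsum := abs_sum_sum_bool_le hterm
  set S := ∑ x, ∑ z, θ.condVar x z * (bern q z * θ.invMean N x) with hS
  set H := ∑ x, ∑ z, θ.condVar x z * θ.cellMean N x z with hH
  set L := ∑ x, ∑ z, θ.condVar x z
    * ((1 - bern p x) / bern p x ^ 2 * (bern q z - 1) * (1 / N)) with hL
  have hdecomp : ∑ x, ∑ z, θ.condVar x z * (bern q z * θ.invMean N x * N - θ.cellMean N x z * N
      - (1 - bern p x) / bern p x ^ 2 * (bern q z - 1) * (1 / N)) = (S - H) * N - L := by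
    rw [hS, hH, hL]
    simp only [Fintype.sum_bool]
    ring
  rw [hdecomp] at hsum
  set W := q * (1 - q) * ((θ.slope true - θ.slope false) ^ 2 / N)
  set u := θ.covRM N
  set v := θ.varM N
  -- Here the common Z-part `W` cancels.
  have e : (u - v) * N - L = ((u - (W + S)) - (v - (W + H))) * N + ((S - H) * N - L) := by ring
  rw [e]
  refine (abs_add_le _ _).trans ?_
  have i1 : |((u - (W + S)) - (v - (W + H))) * N| ≤ 528 * K₂ / N ^ 2 := by
    rw [abs_mul, abs_of_pos hN0]
    calc _ ≤ (528 * (K₂ / N ^ 3)) * N := by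
          gcongr
          exact (abs_sub _ _).trans (by linarith)
      _ = _ := by field_simp
  calc _ ≤ 528 * K₂ / N ^ 2 + 4 * ((K₁ + K₃) / N ^ 2) := add_le_add i1 hsum
    _ = _ := by ring

end Expansion

/-! ### The scaling limit with interaction of order `N^(-1/2)`. -/

section ScalingLimit

variable {pX pZ q₀ q₁ : ℝ}

lemma rpow_neg_half_facts {N : ℕ} (hN : 1 ≤ N) :
    0 < (N : ℝ) ^ (-(1 / 2) : ℝ) ∧ (N : ℝ) ^ (-(1 / 2) : ℝ) ≤ 1 ∧
      ((N : ℝ) ^ (-(1 / 2) : ℝ)) ^ 2 = 1 / N ∧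
      (N : ℝ) ^ (-(3 / 2) : ℝ) = ((N : ℝ) ^ (-(1 / 2) : ℝ)) ^ 3 := by
  have h1 : (1 : ℝ) ≤ N := by exact_mod_cast hN
  have h0 : (0 : ℝ) < N := by linarith
  refine ⟨by positivity, Real.rpow_le_one_of_one_le_of_nonpos h1 (by norm_num), ?_, ?_⟩
  · rw [← Real.rpow_natCast, ← Real.rpow_mul h0.le, one_div (N : ℝ), ← Real.rpow_neg_one]
    norm_num
  · rw [← Real.rpow_natCast, ← Real.rpow_mul h0.le]
    norm_num

lemma tendsto_rpow_neg_half : Tendsto (fun N : ℕ => (N : ℝ) ^ (-(1 / 2) : ℝ)) atTop (nhds 0) :=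
  (tendsto_rpow_neg_atTop (by norm_num)).comp tendsto_natCast_atTop_atTop

/-- The baseline outcome probability in the arm `X = x`. -/
def baseline (q₀ q₁ : ℝ) (x : Bool) : ℝ := if x then q₁ else q₀

lemma abs_interactionParams_sub_le (hZ : 0 < pZ ∧ pZ < 1) (C D : ℝ) (x z : Bool) :
    |(interactionParams pX pZ q₀ q₁ C D).pY x z - baseline q₀ q₁ x| ≤ |C| + |D| := by
  have key : ∀ r : ℝ, 0 ≤ r ∧ r ≤ 1 → |D * r| ≤ |D| := fun r hr => by
    rw [abs_mul, abs_of_nonneg hr.1]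
    exact mul_le_of_le_one_right (abs_nonneg _) hr.2
  have k1 := abs_le.1 (key pZ ⟨hZ.1.le, hZ.2.le⟩)
  have k2 := abs_le.1 (key (1 - pZ) ⟨by linarith, by linarith⟩)
  have c1 := abs_le.1 (le_refl |C|)
  rw [abs_le]
  cases x <;> cases z <;> simp only [interactionParams, baseline, if_true, Bool.false_eq_true,
    if_false] <;> constructor <;> linarith [k1.1, k1.2, k2.1, k2.2, c1.1, c1.2]

lemma abs_condVar_interactionParams_sub_le {C D : ℝ}
    (h : (interactionParams pX pZ q₀ q₁ C D).Valid) (x z : Bool) :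
    |(interactionParams pX pZ q₀ q₁ C D).condVar x z
      - baseline q₀ q₁ x * (1 - baseline q₀ q₁ x)|
      ≤ (|C| + |D|) * (1 + (|C| + |D|)) := by
  have h1 := abs_interactionParams_sub_le (pX := pX) (pZ := pZ) (q₀ := q₀) (q₁ := q₁) h.2.1 C D x z
  have h2 := h.2.2 x z
  rw [Params.condVar]
  set y := (interactionParams pX pZ q₀ q₁ C D).pY x z
  set b := baseline q₀ q₁ x
  rw [show y * (1 - y) - b * (1 - b) = (y - b) * (1 - 2 * y + (y - b)) by ring, abs_mul]
  have h3 : |1 - 2 * y| ≤ 1 := abs_le.2 ⟨by linarith [h2.2], by linarith [h2.1]⟩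
  exact mul_le_mul h1 ((abs_add_le _ _).trans (by linarith)) (abs_nonneg _) (by positivity)

lemma leadM_eq_sum (hX : 0 < pX ∧ pX < 1) (N : ℕ) :
    leadM pX q₀ q₁ N = ∑ x, ∑ z, baseline q₀ q₁ x * (1 - baseline q₀ q₁ x)
      * ((1 - bern pX x) / bern pX x ^ 2 * (bern pZ z - 1) * (1 / N)) := by
  have h1 := hX.1.ne'
  have h2 : 1 - pX ≠ 0 := by linarith [hX.2]
  simp only [leadM, Fintype.sum_bool, baseline, bern, if_true, Bool.false_eq_true, if_false]
  rcases Nat.eq_zero_or_pos N with rfl | hN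
  · simp
  · have : (N : ℝ) ≠ 0 := by positivity
    field_simp
    ring

/-- The slopes are `a = 2C - D` and `b = 2C + D`. The form `(a - b)² - a²/p - b²/(1-p)` equals
`-((1-p) a + p b)² / (p (1-p))`, and `(1-p) a + p b = 2C + (2p-1) D`. -/
lemma leadR_eq (hX : 0 < pX ∧ pX < 1) (C D : ℝ) :
    leadR pX pZ C D = pZ * (1 - pZ) * (((2 * C - D) - (2 * C + D)) ^ 2
      - ((2 * C - D) ^ 2 / pX + (2 * C + D) ^ 2 / (1 - pX))) := by
  have h1 := hX.1.ne'
  have h2 : 1 - pX ≠ 0 := by linarith [hX.2]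
  rw [leadR]
  field_simp
  ring

lemma leadR_nonpos (hX : 0 < pX ∧ pX < 1) (hZ : 0 < pZ ∧ pZ < 1) (C D : ℝ) :
    leadR pX pZ C D ≤ 0 := by
  have h1 := hX.1
  have h2 : 0 < 1 - pX := by linarith [hX.2]
  have h3 := hZ.1
  have h4 : 0 < 1 - pZ := by linarith [hZ.2]
  rw [leadR, neg_nonpos]
  positivity

lemma leadM_eq (pX q₀ q₁ : ℝ) (N : ℕ) :
    leadM pX q₀ q₁ N
      = -(q₁ * (1 - q₁) * ((1 - pX) / pX ^ 2) + q₀ * (1 - q₀) * (pX / (1 - pX) ^ 2)) * (1 / N) := by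
  rw [leadM]
  simp only [div_eq_mul_inv, mul_inv]
  ring

lemma exists_eventually_abs_le {C : ℕ → ℝ}
    (hC : C =O[atTop] (fun N : ℕ => (N : ℝ) ^ (-(1 / 2) : ℝ))) :
    ∃ K : ℝ, 0 < K ∧ ∀ᶠ N : ℕ in atTop, |C N| ≤ K * (N : ℝ) ^ (-(1 / 2) : ℝ) := by
  obtain ⟨K, hK, h⟩ := hC.exists_pos
  refine ⟨K, hK, h.bound.mono fun N hN => ?_⟩
  rwa [Real.norm_eq_abs, Real.norm_eq_abs,
    abs_of_nonneg (by positivity : 0 ≤ (N : ℝ) ^ (-(1 / 2) : ℝ))] at hN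

variable {C D : ℕ → ℝ}

/-- The squared slopes sum to `8C² + 2D² = O(1/N)`, so the uniform error is even `O(N⁻²)`. -/
lemma isBigO_covRM_sub_varR
    (hC : C =O[atTop] (fun N : ℕ => (N : ℝ) ^ (-(1 / 2) : ℝ)))
    (hD : D =O[atTop] (fun N : ℕ => (N : ℝ) ^ (-(1 / 2) : ℝ)))
    (hX : 0 < pX ∧ pX < 1) (hZ : 0 < pZ ∧ pZ < 1)
    (hval : ∀ᶠ N : ℕ in atTop, (interactionParams pX pZ q₀ q₁ (C N) (D N)).Valid) :
    (fun N : ℕ =>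
      ((interactionParams pX pZ q₀ q₁ (C N) (D N)).covRM N
        - (interactionParams pX pZ q₀ q₁ (C N) (D N)).varR N) * (N : ℝ)
        - leadR pX pZ (C N) (D N))
      =O[atTop] (fun N : ℕ => (N : ℝ) ^ (-(3 / 2) : ℝ)) := by
  obtain ⟨Kc, hKc, hC'⟩ := exists_eventually_abs_le hC
  obtain ⟨Kd, hKd, hD'⟩ := exists_eventually_abs_le hD
  obtain ⟨K, hK, hexp⟩ := exists_covRM_sub_varR_expansion hX hZ
  refine IsBigO.of_bound (K * (8 * Kc ^ 2 + 2 * Kd ^ 2 + 1)) ?_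
  filter_upwards [hC', hD', hval, eventually_ge_atTop 1] with N hCN hDN hv hN
  obtain ⟨ht0, ht1, ht2, ht3⟩ := rpow_neg_half_facts hN
  have h := hexp _ N hN hv rfl rfl
  have s1 : (interactionParams pX pZ q₀ q₁ (C N) (D N)).slope true = 2 * C N - D N := by
    simp only [Params.slope, interactionParams]; ring
  have s0 : (interactionParams pX pZ q₀ q₁ (C N) (D N)).slope false = 2 * C N + D N := by
    simp only [Params.slope, interactionParams]; ring
  rw [s1, s0, ← leadR_eq hX] at h
  rw [Real.norm_eq_abs, Real.norm_eq_abs,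
    abs_of_nonneg (by positivity : 0 ≤ (N : ℝ) ^ (-(3 / 2) : ℝ)), ht3]
  refine h.trans ?_
  rw [mul_assoc]
  refine mul_le_mul_of_nonneg_left ?_ hK
  rw [div_eq_mul_one_div, ← one_div_pow, ← ht2]
  set t := (N : ℝ) ^ (-(1 / 2) : ℝ)
  have c2 : C N ^ 2 ≤ (Kc * t) ^ 2 :=
    sq_le_sq' (by linarith [neg_abs_le (C N)]) ((le_abs_self _).trans hCN)
  have d2 : D N ^ 2 ≤ (Kd * t) ^ 2 :=
    sq_le_sq' (by linarith [neg_abs_le (D N)]) ((le_abs_self _).trans hDN)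
  have t4 : (t ^ 2) ^ 2 ≤ t ^ 3 := by
    rw [← pow_mul]
    exact pow_le_pow_of_le_one ht0.le ht1 (by norm_num)
  calc ((2 * C N - D N) ^ 2 + (2 * C N + D N) ^ 2) * t ^ 2 + (t ^ 2) ^ 2
      = (8 * C N ^ 2 + 2 * D N ^ 2) * t ^ 2 + (t ^ 2) ^ 2 := by ring
    _ ≤ (8 * (Kc * t) ^ 2 + 2 * (Kd * t) ^ 2) * t ^ 2 + (t ^ 2) ^ 2 := by gcongr
    _ = (8 * Kc ^ 2 + 2 * Kd ^ 2 + 1) * (t ^ 2) ^ 2 := by ring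
    _ ≤ _ := by gcongr

/-- The order `N^(-3/2)` comes from replacing the conditional variances by `q_x (1 - q_x)`: an error
`O(N^(-1/2))` multiplying a term of order `1/N`. -/
lemma isBigO_covRM_sub_varM
    (hC : C =O[atTop] (fun N : ℕ => (N : ℝ) ^ (-(1 / 2) : ℝ)))
    (hD : D =O[atTop] (fun N : ℕ => (N : ℝ) ^ (-(1 / 2) : ℝ)))
    (hX : 0 < pX ∧ pX < 1) (hZ : 0 < pZ ∧ pZ < 1)
    (hval : ∀ᶠ N : ℕ in atTop, (interactionParams pX pZ q₀ q₁ (C N) (D N)).Valid) :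
    (fun N : ℕ =>
      ((interactionParams pX pZ q₀ q₁ (C N) (D N)).covRM N
        - (interactionParams pX pZ q₀ q₁ (C N) (D N)).varM N) * (N : ℝ)
        - leadM pX q₀ q₁ N)
      =O[atTop] (fun N : ℕ => (N : ℝ) ^ (-(3 / 2) : ℝ)) := by
  obtain ⟨Kc, hKc, hC'⟩ := exists_eventually_abs_le hC
  obtain ⟨Kd, hKd, hD'⟩ := exists_eventually_abs_le hD
  obtain ⟨K, hK, hexp⟩ := exists_covRM_sub_varM_expansion hX hZ
  have hX0 := hX.1
  have hX1 : 0 < 1 - pX := by linarith [hX.2]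
  set A : ℝ := (1 - pX) / pX ^ 2 + pX / (1 - pX) ^ 2 with hA
  have hA0 : 0 ≤ A := by positivity
  set Q : ℝ := (Kc + Kd) * (1 + (Kc + Kd)) with hQ
  have hQ0 : 0 ≤ Q := by positivity
  refine IsBigO.of_bound (K + 4 * (Q * A)) ?_
  filter_upwards [hC', hD', hval, eventually_ge_atTop 1] with N hCN hDN hv hN
  obtain ⟨ht0, ht1, ht2, ht3⟩ := rpow_neg_half_facts hN
  have h := hexp _ N hN hv rfl rfl
  rw [Real.norm_eq_abs, Real.norm_eq_abs,
    abs_of_nonneg (by positivity : 0 ≤ (N : ℝ) ^ (-(3 / 2) : ℝ)), ht3]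
  set t := (N : ℝ) ^ (-(1 / 2) : ℝ)
  have hv' : ∀ x z, |(interactionParams pX pZ q₀ q₁ (C N) (D N)).condVar x z
      - baseline q₀ q₁ x * (1 - baseline q₀ q₁ x)| ≤ Q * t := fun x z => by
    refine (abs_condVar_interactionParams_sub_le hv x z).trans ?_
    have i1 : |C N| + |D N| ≤ (Kc + Kd) * t := by linarith
    have i2 : (Kc + Kd) * t ≤ Kc + Kd := mul_le_of_le_one_right (by positivity) ht1
    calc _ ≤ ((Kc + Kd) * t) * (1 + (Kc + Kd)) :=
          mul_le_mul i1 (by linarith) (by positivity) (by positivity)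
      _ = _ := by rw [hQ]; ring
  have hL := abs_sum_sum_bool_le (K := Q * A * t ^ 3) (t := fun x z =>
    ((interactionParams pX pZ q₀ q₁ (C N) (D N)).condVar x z
      - baseline q₀ q₁ x * (1 - baseline q₀ q₁ x))
      * ((1 - bern pX x) / bern pX x ^ 2 * (bern pZ z - 1) * (1 / N))) (fun x z => by
    have hb := bern_pos hX x
    have hb1 := bern_lt_one hX x
    have hbz := bern_pos hZ z
    have hbz1 := bern_lt_one hZ z
    have hAx : (1 - bern pX x) / bern pX x ^ 2 ≤ A := by
      have i1 : 0 ≤ (1 - pX) / pX ^ 2 := by positivity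
      have i2 : 0 ≤ pX / (1 - pX) ^ 2 := by positivity
      cases x
      · simp only [bern, Bool.false_eq_true, if_false, sub_sub_cancel]; linarith
      · simp only [bern, if_true]; linarith
    have hA1 : 0 ≤ (1 - bern pX x) / bern pX x ^ 2 := div_nonneg (by linarith) (by positivity)
    have hz : |bern pZ z - 1| ≤ 1 := abs_le.2 ⟨by linarith, by linarith⟩
    rw [← ht2, abs_mul, abs_mul, abs_mul, abs_of_nonneg hA1, abs_of_nonneg (sq_nonneg t)]
    calc _ ≤ (Q * t) * (A * 1 * t ^ 2) := by
          gcongr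
          exact hv' x z
      _ = _ := by ring)
  have hdec : ∑ x, ∑ z, ((interactionParams pX pZ q₀ q₁ (C N) (D N)).condVar x z
      - baseline q₀ q₁ x * (1 - baseline q₀ q₁ x))
      * ((1 - bern pX x) / bern pX x ^ 2 * (bern pZ z - 1) * (1 / N))
      = ∑ x, ∑ z, (interactionParams pX pZ q₀ q₁ (C N) (D N)).condVar x z
        * ((1 - bern pX x) / bern pX x ^ 2 * (bern pZ z - 1) * (1 / N)) - leadM pX q₀ q₁ N := by
    rw [leadM_eq_sum (pZ := pZ) hX]
    simp only [sub_mul, Finset.sum_sub_distrib]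
  rw [hdec] at hL
  refine (abs_sub_le _ _ _).trans ((add_le_add h hL).trans ?_)
  have t4 : (t ^ 2) ^ 2 ≤ t ^ 3 := by
    rw [← pow_mul]
    exact pow_le_pow_of_le_one ht0.le ht1 (by norm_num)
  rw [← one_div_pow, ← ht2]
  nlinarith

/-- The baseline probabilities are limits of probabilities. -/
lemma baseline_mem
    (hC : C =O[atTop] (fun N : ℕ => (N : ℝ) ^ (-(1 / 2) : ℝ)))
    (hD : D =O[atTop] (fun N : ℕ => (N : ℝ) ^ (-(1 / 2) : ℝ)))
    (hZ : 0 < pZ ∧ pZ < 1)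
    (hval : ∀ᶠ N : ℕ in atTop, (interactionParams pX pZ q₀ q₁ (C N) (D N)).Valid) (x : Bool) :
    0 ≤ baseline q₀ q₁ x ∧ baseline q₀ q₁ x ≤ 1 := by
  have hC0 := (hC.trans_tendsto tendsto_rpow_neg_half).abs
  have hD0 := (hD.trans_tendsto tendsto_rpow_neg_half).abs
  have hsum := hC0.add hD0
  rw [abs_zero, add_zero] at hsum
  have hlim : Tendsto (fun N => (interactionParams pX pZ q₀ q₁ (C N) (D N)).pY x true) atTop
      (nhds (baseline q₀ q₁ x)) := by
    rw [tendsto_iff_norm_sub_tendsto_zero]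
    exact squeeze_zero (fun _ => norm_nonneg _)
      (fun N => abs_interactionParams_sub_le hZ (C N) (D N) x true) hsum
  exact ⟨ge_of_tendsto hlim (hval.mono fun N h => (h.2.2 x true).1),
    le_of_tendsto hlim (hval.mono fun N h => (h.2.2 x true).2)⟩

/-- A quantity whose scaled version has a negative leading term of order `1 / N` is eventually
negative. -/
lemma eventually_neg_of_isBigO {u L : ℕ → ℝ} {κ : ℝ} (hκ : 0 < κ)
    (hu : (fun N : ℕ => u N * (N : ℝ) - L N) =O[atTop] (fun N : ℕ => (N : ℝ) ^ (-(3 / 2) : ℝ)))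
    (hL : ∀ᶠ N : ℕ in atTop, L N ≤ -κ * (1 / N)) : ∀ᶠ N : ℕ in atTop, u N < 0 := by
  obtain ⟨K, hK, h⟩ := hu.exists_pos
  have hsmall : ∀ᶠ N : ℕ in atTop, (N : ℝ) ^ (-(1 / 2) : ℝ) < κ / K :=
    tendsto_rpow_neg_half.eventually_lt_const (by positivity)
  filter_upwards [h.bound, hL, hsmall, eventually_ge_atTop 1] with N hN hLN hs h1
  obtain ⟨ht0, ht1, ht2, ht3⟩ := rpow_neg_half_facts h1
  have hN0 : (0 : ℝ) < N := by exact_mod_cast h1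
  rw [Real.norm_eq_abs, Real.norm_eq_abs,
    abs_of_nonneg (by positivity : 0 ≤ (N : ℝ) ^ (-(3 / 2) : ℝ)), ht3] at hN
  rw [← ht2] at hLN
  set t := (N : ℝ) ^ (-(1 / 2) : ℝ)
  rw [lt_div_iff₀ hK] at hs
  -- With `t = N^(-1/2)`, the error `K t³` is below the leading term `κ t²` once `t < κ / K`.
  have h2 : K * t ^ 3 < κ * t ^ 2 := by
    rw [show K * t ^ 3 = (t * K) * t ^ 2 by ring]
    gcongr
  have h3 : u N * N < 0 := by linarith [(abs_le.1 hN).2]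
  exact neg_of_mul_neg_left h3 hN0.le

end ScalingLimit

end VStructure

end

theorem mainTheorem5 :
    -- whenever the covariance is below both variances, the weight `α*` is optimal and improves
    -- strictly on both estimators
    (∀ (θ : VStructure.Params) (N : ℕ), θ.Valid →
      θ.covRM N < min (θ.varR N) (θ.varM N) →
        (∀ α : ℝ, θ.varP N (θ.optWeight N) ≤ θ.varP N α) ∧
        θ.varP N (θ.optWeight N) < min (θ.varR N) (θ.varM N)) ∧
    -- the scaling limit
    ∀ (pX pZ q₀ q₁ : ℝ) (C D : ℕ → ℝ),
      C =O[atTop] (fun N : ℕ => (N : ℝ) ^ (-(1 / 2) : ℝ)) →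
      D =O[atTop] (fun N : ℕ => (N : ℝ) ^ (-(1 / 2) : ℝ)) →
      (∀ᶠ N : ℕ in atTop,
        (VStructure.interactionParams pX pZ q₀ q₁ (C N) (D N)).Valid) →
      -- the two expansions
      (fun N : ℕ =>
          ((VStructure.interactionParams pX pZ q₀ q₁ (C N) (D N)).covRM N
            - (VStructure.interactionParams pX pZ q₀ q₁ (C N) (D N)).varR N) * (N : ℝ)
            - VStructure.leadR pX pZ (C N) (D N))
        =O[atTop] (fun N : ℕ => (N : ℝ) ^ (-(3 / 2) : ℝ)) ∧
      (fun N : ℕ =>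
          ((VStructure.interactionParams pX pZ q₀ q₁ (C N) (D N)).covRM N
            - (VStructure.interactionParams pX pZ q₀ q₁ (C N) (D N)).varM N) * (N : ℝ)
            - VStructure.leadM pX q₀ q₁ N)
        =O[atTop] (fun N : ℕ => (N : ℝ) ^ (-(3 / 2) : ℝ)) ∧
      -- the leading terms are non-positive
      (∀ N : ℕ, VStructure.leadR pX pZ (C N) (D N) ≤ 0 ∧ VStructure.leadM pX q₀ q₁ N ≤ 0) ∧
      -- `C[R, M] < min (V[R], V[M])` in the generic case, and `P(α*)` then beats `R` and `M`
      (((0 < q₀ ∧ q₀ < 1) ∨ (0 < q₁ ∧ q₁ < 1)) →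
        (fun N : ℕ => (N : ℝ) ^ (-(1 / 2) : ℝ))
          =O[atTop] (fun N : ℕ => 2 * C N + (2 * pX - 1) * D N) →
        ∀ᶠ N : ℕ in atTop,
          (VStructure.interactionParams pX pZ q₀ q₁ (C N) (D N)).covRM N
            < min ((VStructure.interactionParams pX pZ q₀ q₁ (C N) (D N)).varR N)
                ((VStructure.interactionParams pX pZ q₀ q₁ (C N) (D N)).varM N) ∧
          (VStructure.interactionParams pX pZ q₀ q₁ (C N) (D N)).varP N
              ((VStructure.interactionParams pX pZ q₀ q₁ (C N) (D N)).optWeight N)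
            < min ((VStructure.interactionParams pX pZ q₀ q₁ (C N) (D N)).varR N)
                ((VStructure.interactionParams pX pZ q₀ q₁ (C N) (D N)).varM N)) := by
  refine ⟨fun θ N hθ hlt => hθ.varP_optWeight hlt, ?_⟩
  intro pX pZ q₀ q₁ C D hC hD hval
  obtain ⟨N₀, hN₀⟩ := hval.exists
  have hX : 0 < pX ∧ pX < 1 := hN₀.1
  have hZ : 0 < pZ ∧ pZ < 1 := hN₀.2.1
  have hX0 := hX.1
  have hX1 : 0 < 1 - pX := by linarith [hX.2]
  have hZ0 := hZ.1
  have hZ1 : 0 < 1 - pZ := by linarith [hZ.2]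
  have hq₁ : 0 ≤ q₁ ∧ q₁ ≤ 1 := VStructure.baseline_mem hC hD hZ hval true
  have hq₀ : 0 ≤ q₀ ∧ q₀ ≤ 1 := VStructure.baseline_mem hC hD hZ hval false
  have hR := VStructure.isBigO_covRM_sub_varR hC hD hX hZ hval
  have hM := VStructure.isBigO_covRM_sub_varM hC hD hX hZ hval
  have m₁ : 0 ≤ q₁ * (1 - q₁) := mul_nonneg hq₁.1 (by linarith [hq₁.2])
  have m₀ : 0 ≤ q₀ * (1 - q₀) := mul_nonneg hq₀.1 (by linarith [hq₀.2])
  have w₁ : 0 < (1 - pX) / pX ^ 2 := by positivity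
  have w₀ : 0 < pX / (1 - pX) ^ 2 := by positivity
  refine ⟨hR, hM, fun N => ⟨VStructure.leadR_nonpos hX hZ _ _, ?_⟩, fun hq hCD => ?_⟩
  · rw [VStructure.leadM_eq, neg_mul, neg_nonpos]
    positivity
  -- Squaring `N^(-1/2) ≤ K |2C + (2pX - 1) D|` bounds the square in `leadR` below by `1 / (K² N)`,
  -- which gives the constant `κ` for `V[R]`.
  obtain ⟨K, hK, hlow⟩ := hCD.exists_pos
  have hVR := VStructure.eventually_neg_of_isBigO
    (κ := pZ * (1 - pZ) / (pX * (1 - pX)) / K ^ 2) (by positivity) hR (by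
      filter_upwards [hlow.bound, eventually_ge_atTop 1] with N hN h1
      obtain ⟨ht0, -, ht2, -⟩ := VStructure.rpow_neg_half_facts h1
      rw [Real.norm_eq_abs, Real.norm_eq_abs, abs_of_nonneg ht0.le] at hN
      have hsq := pow_le_pow_left₀ ht0.le hN 2
      rw [mul_pow, sq_abs, ht2, ← div_le_iff₀' (by positivity)] at hsq
      rw [VStructure.leadR, neg_mul, neg_le_neg_iff, div_mul_eq_mul_div, mul_div_assoc]
      gcongr)
  have hVM := VStructure.eventually_neg_of_isBigO
    (κ := q₁ * (1 - q₁) * ((1 - pX) / pX ^ 2) + q₀ * (1 - q₀) * (pX / (1 - pX) ^ 2)) (by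
      rcases hq with hq | hq
      · have : 0 < q₀ * (1 - q₀) := mul_pos hq.1 (by linarith [hq.2])
        positivity
      · have : 0 < q₁ * (1 - q₁) := mul_pos hq.1 (by linarith [hq.2])
        positivity) hM (Eventually.of_forall fun N => (VStructure.leadM_eq pX q₀ q₁ N).le)
  filter_upwards [hval, hVR, hVM] with N hv h1 h2
  have hlt := lt_min (sub_neg.1 h1) (sub_neg.1 h2)
  exact ⟨hlt, (hv.varP_optWeight hlt).2⟩
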